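/- Let $p$ be an odd prime. Let $\Gamma(p)=\ker(\mathrm{SL}_3(\mathbb Z)\to \mathrm{SL}_3(\mathbb Z/p))$ and $\Gamma_2(p)=\ker(\mathrm{SL}_2(\mathbb Z)\to \mathrm{SL}_2(\mathbb Z/p))$ be the principal congruence subgroups of level $p$, and let $P_2\subset \mathrm{SL}_3(\mathbb Z)$ be the parabolic subgroup of matrices whose third row has zeros in its first and second entries. Let $M=\mathbb Z^2$ be the natural representation of $\Gamma_2(p)$ (matrices acting on column vectors), and let $M^*=\mathrm{Hom}_{\mathbb Z}(M,\mathbb Z)$ be its dual, with action $(g\cdot f)(v)=f(g^{-1}v)$. Then, as abelian groups, $$H^i(P_2\cap\Gamma(p),\mathbb Z)\cong\begin{cases}\mathbb Z & i=0,\\ H^1(\Gamma_2(p),\mathbb Z) & i=1,\\ H^1(\Gamma_2(p),M^*)\oplus\mathbb Z & i=2,\\ H^1(\Gamma_2(p),\mathbb Z) & i=3,\\ 0 & i\ge 4,\end{cases}$$ where $H^i$ denotes group cohomology and $\mathbb Z$ carries the trivial action. -/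

import Mathlib

open scoped MatrixGroups

noncomputable section

/-- The principal congruence subgroup `Γ(p)` of level `p` in `SL₃(ℤ)`: the kernel of reduction
modulo `p`. -/
def Gamma3 (p : ℕ) : Subgroup SL(3, ℤ) :=
  (Matrix.SpecialLinearGroup.map (n := Fin 3) (Int.castRingHom (ZMod p))).ker

/-- The standard maximal parabolic subgroup `P₂` of `SL₃(ℤ)` (the one other than the stabilizer of
the line spanned by the first basis vector): the matrices whose third row has zeros in
its first and second entries. -/
def parabolicP2 : Subgroup SL(3, ℤ) where
  carrier := {g | g.1 2 0 = 0 ∧ g.1 2 1 = 0}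
  one_mem' := by simp
  mul_mem' := by
    rintro a b ⟨ha0, ha1⟩ ⟨hb0, hb1⟩
    constructor <;>
      simp [Matrix.SpecialLinearGroup.coe_mul, Matrix.mul_apply, Fin.sum_univ_three, *]
  inv_mem' := by
    rintro a ⟨ha0, ha1⟩
    constructor <;>
      simp [Matrix.SpecialLinearGroup.coe_inv, Matrix.adjugate_fin_three, *]

/-- The natural representation `M = ℤ²` of the level `p` principal congruence subgroup
`Γ₂(p)` of `SL₂(ℤ)`, acting on column vectors by matrix multiplication. -/
def naturalRep (p : ℕ) : Representation ℤ (CongruenceSubgroup.Gamma p) (Fin 2 → ℤ) where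
  toFun g := Matrix.mulVecLin (g : SL(2, ℤ)).1
  map_one' := by simp [Module.End.one_eq_id]
  map_mul' g h := by simp [Matrix.mulVecLin_mul, Module.End.mul_eq_comp]

/-- The dual `M* = Hom(ℤ², ℤ)` of the natural representation, with `(g • f)(v) = f (g⁻¹ v)`. -/
def dualRep (p : ℕ) : Rep.{0} ℤ (CongruenceSubgroup.Gamma p) :=
  Rep.of (naturalRep p).dual

/-- Integral group cohomology `Hⁱ(G, ℤ)`, with trivial action of `G` on `ℤ`. -/
abbrev integralCohomology (G : Type) [Group G] (i : ℕ) : ModuleCat.{0} ℤ :=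
  groupCohomology (Rep.trivial ℤ G ℤ) i

end

/-! Since $p>2$, every matrix in $G=P_2\cap\Gamma(p)$ has lower right entry $1$. Hence
$G=\Gamma\ltimes N$ with $\Gamma=\Gamma_2(p)$ and $N=p\mathbb Z^2$, and division by $p$ identifies
$N$ with $M$. The groups $H^n(N,\mathbb Z)$ for $n=0,1,2$ are $\mathbb Z$, $M^*$ and $\mathbb Z$,
and they vanish above; the action on $H^2$ is trivial because $\Gamma$ has determinant one. As
$\Gamma$ has cohomological dimension at most one, the Lyndon-Hochschild-Serre spectral sequence
reduces to $$0\to H^1(\Gamma,H^{n-1}(N,\mathbb Z))\to H^n(G,\mathbb Z)\to H^n(N,\mathbb Z)^\Gamma\to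
0.$$ With $(M^*)^\Gamma=0$ this gives every case; for $n=2$ the sequence splits because its right
end is $\mathbb Z$.

The spectral sequence itself is not used. With $A'$ the cokernel of $A$ in the functions $G\to A$,
`shiftEquiv` moves each degree down to degree one, where explicit cocycles suffice.
Inflation-restriction is `exists_inflate` and `exists_extension`, and `nonempty_invHOne_shift_equiv`
replaces $H^1(\Gamma,(A')^N)$ by $H^1(\Gamma,H^1(N,A))$. For the lattice, $H^1(N,\mathbb
Z')=H^2(N,\mathbb Z)$ is detected by the commutator pairing (`commPairing_eq_zero_iff`), and
$H^1(N,A'')=H^3(N,A)$ vanishes (`mem_B1_shift_shift`).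

Dimension at most one enters as `LiftsCocycles`. Ping-pong on the upper half plane shows that
$\mathrm{PSL}_2(\mathbb Z)$ is a free product of cyclic groups of orders two and three
(`fromCoprod_injective`), and $\Gamma$ meets no conjugate of a factor. Instead of deducing that
$\Gamma$ is free, `liftsCocycles_of_coprodI` lifts cocycles directly; this is the free action on the
Bass-Serre tree in algebraic form. -/

open scoped MatrixGroups

noncomputable section

namespace Representation

/-! ### Degree-one cohomology by explicit cocycles. -/

section Cocycles

variable {k G A : Type} [CommRing k] [Group G] [AddCommGroup A] [Module k A]

/-- The `1`-cocycles of a representation. -/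
def Z1 (ρ : Representation k G A) : Submodule k (G → A) where
  carrier := {z | ∀ g h, z (g * h) = z g + ρ g (z h)}
  zero_mem' := by simp
  add_mem' {a b} ha hb g h := by simp only [Pi.add_apply, ha g h, hb g h, map_add]; abel
  smul_mem' r a ha g h := by simp only [Pi.smul_apply, ha g h, map_smul, smul_add]

/-- The coboundary map from elements to `1`-cochains. -/
def coboundary (ρ : Representation k G A) : A →ₗ[k] G → A :=
  LinearMap.pi fun g => ρ g - LinearMap.id

@[simp]
lemma coboundary_apply (ρ : Representation k G A) (a : A) (g : G) :
    ρ.coboundary a g = ρ g a - a := rfl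

/-- The `1`-coboundaries of a representation. -/
def B1 (ρ : Representation k G A) : Submodule k (G → A) := LinearMap.range ρ.coboundary

variable (ρ : Representation k G A)

lemma mem_Z1 {z : G → A} : z ∈ ρ.Z1 ↔ ∀ g h, z (g * h) = z g + ρ g (z h) := Iff.rfl

lemma mem_B1 {z : G → A} : z ∈ ρ.B1 ↔ ∃ a, ∀ g, z g = ρ g a - a :=
  ⟨fun ⟨a, ha⟩ => ⟨a, fun g => (congrFun ha g).symm⟩, fun ⟨a, ha⟩ => ⟨a, funext fun g => (ha g).symm⟩⟩

lemma B1_le_Z1 : ρ.B1 ≤ ρ.Z1 := by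
  rintro z hz g h
  obtain ⟨a, ha⟩ := ρ.mem_B1.1 hz
  simp [ha]

variable {ρ} in
lemma Z1_map_one {z : G → A} (hz : z ∈ ρ.Z1) : z 1 = 0 := by
  simpa using hz 1 1

variable {ρ} in
lemma Z1_map_inv {z : G → A} (hz : z ∈ ρ.Z1) (g : G) : z g⁻¹ = -ρ g⁻¹ (z g) := by
  have h := hz g⁻¹ g
  rw [inv_mul_cancel, Z1_map_one hz] at h
  exact eq_neg_of_add_eq_zero_left h.symm

/-- The first cohomology of a representation as cocycles modulo coboundaries. -/
abbrev HOne : Type := ρ.Z1 ⧸ ρ.B1.submoduleOf ρ.Z1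

/-- The comparison of `HOne` with Mathlib's group cohomology in degree one. -/
def hOneEquiv : groupCohomology (Rep.of ρ) 1 ≃ₗ[k] ρ.HOne := by
  have hZ (z : G → A) : z ∈ groupCohomology.cocycles₁ (Rep.of ρ) ↔ z ∈ ρ.Z1 := by
    rw [groupCohomology.mem_cocycles₁_iff, mem_Z1]
    exact forall₂_congr fun g h => by rw [add_comm]
  let e : ρ.Z1 ≃ₗ[k] groupCohomology.cocycles₁ (Rep.of ρ) :=
    LinearEquiv.ofEq _ _ (Submodule.ext fun z => (hZ z).symm)
  let f : ρ.Z1 →ₗ[k] groupCohomology (Rep.of ρ) 1 :=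
    (groupCohomology.H1π (Rep.of ρ)).hom ∘ₗ e.toLinearMap
  have hf : Function.Surjective f := by
    have h := (ModuleCat.epi_iff_surjective (groupCohomology.H1π (Rep.of ρ))).1 inferInstance
    exact h.comp e.surjective
  have hker : ρ.B1.submoduleOf ρ.Z1 = LinearMap.ker f := by
    ext z
    rw [LinearMap.mem_ker]
    exact (groupCohomology.H1π_eq_zero_iff (A := Rep.of ρ) (e z)).symm
  exact ((Submodule.quotEquivOfEq _ _ hker).trans (f.quotKerEquivOfSurjective hf)).symm

variable {H B : Type} [Group H] [AddCommGroup B] [Module k B]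

/-- A map on `HOne` from a linear map of cocycles preserving coboundaries. -/
def HOne.map {ρ : Representation k G A} {σ : Representation k H B} (f : ρ.Z1 →ₗ[k] σ.Z1)
    (hf : ∀ z : ρ.Z1, z.1 ∈ ρ.B1 → (f z).1 ∈ σ.B1) : ρ.HOne →ₗ[k] σ.HOne :=
  Submodule.mapQ _ _ f fun z hz => hf z hz

/-- Criterion for a map of cocycles to induce an isomorphism on first cohomology. -/
lemma HOne.nonempty_equiv {ρ : Representation k G A} {σ : Representation k H B}
    (f : ρ.Z1 →ₗ[k] σ.Z1) (hf : ∀ z : ρ.Z1, z.1 ∈ ρ.B1 → (f z).1 ∈ σ.B1)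
    (hinj : ∀ z : ρ.Z1, (f z).1 ∈ σ.B1 → z.1 ∈ ρ.B1)
    (hsurj : ∀ w : σ.Z1, ∃ z : ρ.Z1, w.1 - (f z).1 ∈ σ.B1) :
    Nonempty (ρ.HOne ≃ₗ[k] σ.HOne) := by
  refine ⟨LinearEquiv.ofBijective (HOne.map f hf) ⟨?_, ?_⟩⟩
  · rw [← LinearMap.ker_eq_bot, LinearMap.ker_eq_bot']
    intro m hm
    obtain ⟨z, rfl⟩ := Submodule.Quotient.mk_surjective _ m
    exact (Submodule.Quotient.mk_eq_zero _).2 (hinj z ((Submodule.Quotient.mk_eq_zero (σ.B1.submoduleOf σ.Z1)).1 hm))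
  · intro m
    obtain ⟨w, rfl⟩ := Submodule.Quotient.mk_surjective _ m
    obtain ⟨z, hz⟩ := hsurj w
    refine ⟨Submodule.Quotient.mk z, ?_⟩
    exact ((Submodule.Quotient.eq (σ.B1.submoduleOf σ.Z1)).2 hz).symm

end Cocycles

/-! ### Dimension shifting. -/

section Shift

variable {k G A : Type} [CommRing k] [Group G] [AddCommGroup A] [Module k A]

variable (k G A) in
/-- Functions on `G` vanishing at the identity. -/
def shiftV : Submodule k (G → A) := LinearMap.ker (LinearMap.proj (R := k) (φ := fun _ : G => A) 1)

lemma mem_shiftV {f : G → A} : f ∈ shiftV k G A ↔ f 1 = 0 := Iff.rfl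

instance : FunLike (shiftV k G A) G A := ⟨Subtype.val, Subtype.val_injective⟩

lemma shiftV_ext {f g : shiftV k G A} (h : ∀ x, f x = g x) : f = g := DFunLike.ext _ _ h

@[simp] lemma shiftV_coe (f : shiftV k G A) (x : G) : f.1 x = f x := rfl

@[simp] lemma shiftV_mk (f : G → A) (hf : f ∈ shiftV k G A) (x : G) :
  (⟨f, hf⟩ : shiftV k G A) x = f x := rfl

@[simp] lemma shiftV_one (f : shiftV k G A) : f 1 = 0 := f.2

@[simp] lemma shiftV_add (f g : shiftV k G A) (x : G) : (f + g) x = f x + g x := rfl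
@[simp] lemma shiftV_sub (f g : shiftV k G A) (x : G) : (f - g) x = f x - g x := rfl
@[simp] lemma shiftV_smul (r : k) (f : shiftV k G A) (x : G) : (r • f) x = r • f x := rfl
@[simp] lemma shiftV_zero (x : G) : (0 : shiftV k G A) x = 0 := rfl

/-- The dimension shift of a representation: the cokernel of its embedding in the coinduced
representation, realised as the functions on `G` vanishing at the identity. -/
def shift (ρ : Representation k G A) : Representation k G (shiftV k G A) where
  toFun g :=
    { toFun f := ⟨fun x => f (x * g) - ρ x (f g), by simp [mem_shiftV]⟩
      map_add' a b := by
        apply shiftV_ext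
        intro x
        simp only [shiftV_mk, shiftV_add, map_add]
        abel
      map_smul' r a := by
        apply shiftV_ext
        intro x
        simp [smul_sub] }
  map_one' := by
    refine LinearMap.ext fun f => shiftV_ext fun x => ?_
    simp
  map_mul' g h := by
    refine LinearMap.ext fun f => shiftV_ext fun x => ?_
    simp [mul_assoc]

@[simp]
lemma shift_apply (ρ : Representation k G A) (g : G) (f : shiftV k G A) (x : G) :
    ρ.shift g f x = f (x * g) - ρ x (f g) := rfl

/-- The coinduced representation of the underlying module of `A`. -/
abbrev fullCoind (ρ : Representation k G A) : Rep k G :=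
  Rep.coind (⊥ : Subgroup G).subtype (Rep.of (ρ.comp (⊥ : Subgroup G).subtype))

/-- The projection from functions to functions vanishing at the identity. -/
def toShift (ρ : Representation k G A) : (G → A) →ₗ[k] shiftV k G A :=
  LinearMap.codRestrict _
    (LinearMap.pi fun x : G => (LinearMap.proj x : (G → A) →ₗ[k] A) -
      ρ x ∘ₗ (LinearMap.proj (1 : G) : (G → A) →ₗ[k] A))
    fun f => by simp [mem_shiftV]

@[simp]
lemma toShift_apply (ρ : Representation k G A) (f : G → A) (x : G) :
    ρ.toShift f x = f x - ρ x (f 1) := rfl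

/-- The short exact sequence `A → J(A) → A'` defining the dimension shift. -/
def shiftSequence (ρ : Representation k G A) : CategoryTheory.ShortComplex (Rep k G) where
  X₁ := Rep.of ρ
  X₂ := ρ.fullCoind
  X₃ := Rep.of ρ.shift
  f := Rep.ofHom
    { toFun a := ⟨fun x => ρ x a, fun s x => by
        have : s = 1 := Subsingleton.elim _ _
        subst this; simp⟩
      map_add' a b := by ext; simp
      map_smul' r a := by ext; simp
      isIntertwining' g := by
        ext a x
        exact (LinearMap.congr_fun (map_mul ρ x g) a).symm }
  g := Rep.ofHom
    { __ := ρ.toShift ∘ₗ Submodule.subtype _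
      isIntertwining' g := by
        refine LinearMap.ext fun f => shiftV_ext fun x => ?_
        change f.1 (x * g) - ρ x (f.1 (1 * g)) = (f.1 (x * g) - ρ (x * g) (f.1 1)) -
          ρ x (f.1 g - ρ g (f.1 1))
        simp }
  zero := by
    refine Rep.hom_ext (Representation.IntertwiningMap.ext (LinearMap.ext fun a => ?_))
    refine shiftV_ext fun x => ?_
    change ρ x a - ρ x (ρ 1 a) = 0
    simp

lemma shiftSequence_shortExact (ρ : Representation k G A) : ρ.shiftSequence.ShortExact where
  exact := by
    rw [← CategoryTheory.ShortComplex.exact_map_iff_of_faithful _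
      (CategoryTheory.forget₂ (Rep k G) (ModuleCat k)),
      CategoryTheory.ShortComplex.moduleCat_exact_iff]
    intro f hf
    refine ⟨f.1 1, Subtype.ext (funext fun x => ?_)⟩
    exact (sub_eq_zero.1 (congrFun (congrArg Subtype.val hf) x)).symm
  mono_f := by
    rw [Rep.mono_iff_injective]
    intro a b hab
    have h : ρ 1 a = ρ 1 b := congrFun (congrArg Subtype.val hab) 1
    rwa [map_one] at h
  epi_g := by
    rw [Rep.epi_iff_surjective]
    intro f
    change shiftV k G A at f
    refine ⟨⟨f.1, fun s x => ?_⟩, ?_⟩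
    · have : s = 1 := Subsingleton.elim _ _
      subst this
      simp
    · refine shiftV_ext fun x => ?_
      exact (congrArg (f x - ·) ((congrArg (ρ x) (shiftV_one f)).trans (map_zero _))).trans
        (sub_zero _)

/-- Shapiro's lemma for the trivial subgroup. -/
lemma isZero_fullCoind (ρ : Representation k G A) (n : ℕ) :
    CategoryTheory.Limits.IsZero (groupCohomology ρ.fullCoind (n + 1)) :=
  (isZero_groupCohomology_succ_of_subsingleton _ n).of_iso (groupCohomology.coindIso _ _)

/-- Dimension shifting for group cohomology. -/
def shiftEquiv (ρ : Representation k G A) (n : ℕ) :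
    groupCohomology (Rep.of ρ) (n + 2) ≃ₗ[k] groupCohomology (Rep.of ρ.shift) (n + 1) :=
  haveI := groupCohomology.isIso_δ_of_isZero ρ.shiftSequence_shortExact (n + 1)
    (ρ.isZero_fullCoind n) (ρ.isZero_fullCoind (n + 1))
  (CategoryTheory.asIso
    (groupCohomology.δ ρ.shiftSequence_shortExact (n + 1) (n + 2) rfl)).toLinearEquiv.symm

end Shift

end Representation

/-! ### Groups of cohomological dimension at most one. -/

namespace Representation

section Restrict

variable {k Γ V : Type} [CommRing k] [Group Γ] [AddCommGroup V] [Module k V]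

/-- The representation on an invariant submodule. -/
def onSubmodule (σ : Representation k Γ V) (W : Submodule k V)
    (h : ∀ q, ∀ w ∈ W, σ q w ∈ W) : Representation k Γ W where
  toFun q := (σ q).restrict (h q)
  map_one' := by ext; simp
  map_mul' q r := by ext; simp

end Restrict

/-- A group has liftable cocycles if `1`-cocycles lift along surjections of representations. This
says that the cohomological dimension is at most one. -/
def LiftsCocycles (k Γ : Type) [CommRing k] [Group Γ] : Prop :=
  ∀ (B C : Type) [AddCommGroup B] [AddCommGroup C] [Module k B] [Module k C]
    (ρ : Representation k Γ B) (σ : Representation k Γ C) (f : B →ₗ[k] C),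
    (∀ g b, f (ρ g b) = σ g (f b)) → Function.Surjective f →
    ∀ c ∈ σ.Z1, ∃ b ∈ ρ.Z1, ∀ g, f (b g) = c g

section LiftsCocycles

variable {k Γ A B C : Type} [CommRing k] [Group Γ] [AddCommGroup A] [Module k A]
  [AddCommGroup B] [Module k B] [AddCommGroup C] [Module k C]

/-- Functions on a group with the action by right translation. -/
def rightRegular : Representation k Γ (Γ → A) where
  toFun q := LinearMap.funLeft k A (· * q)
  map_one' := by ext; simp
  map_mul' q r := by
    refine LinearMap.ext fun f => funext fun x => ?_
    simp [LinearMap.funLeft_apply, mul_assoc]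

@[simp]
lemma rightRegular_apply (q : Γ) (f : Γ → A) (x : Γ) :
    rightRegular (k := k) q f x = f (x * q) := rfl

/-- Shapiro's lemma in degree one: evaluating the cocycle identity at the identity element exhibits
the primitive. -/
lemma mem_B1_rightRegular {z : Γ → Γ → A} (hz : z ∈ (rightRegular (k := k)).Z1) :
    z ∈ (rightRegular (k := k)).B1 := by
  refine (mem_B1 _).2 ⟨fun y => z y 1, fun q => funext fun y => ?_⟩
  have h := congrFun (hz y q) 1
  simp only [Pi.add_apply, rightRegular_apply, one_mul] at h
  simp [h]

/-- If cocycles lift, then a surjection of representations whose kernel is a quotient of an acyclic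
representation induces an isomorphism on first cohomology. -/
theorem HOne.nonempty_equiv_of_surjective (hΓ : LiftsCocycles k Γ)
    (ρ : Representation k Γ A) (τ : Representation k Γ B) (σ : Representation k Γ C)
    (θ : A →ₗ[k] B) (L : C →ₗ[k] A) (hθ : ∀ q a, θ (ρ q a) = τ q (θ a))
    (hsurj : Function.Surjective θ) (hL : ∀ q c, L (σ q c) = ρ q (L c))
    (hker : ∀ a, θ a = 0 ↔ a ∈ LinearMap.range L) (hσ : ∀ z ∈ σ.Z1, z ∈ σ.B1) :
    Nonempty (ρ.HOne ≃ₗ[k] τ.HOne) := by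
  let F : ρ.Z1 →ₗ[k] τ.Z1 :=
    { toFun c := ⟨fun q => θ (c.1 q), fun q r => by
        beta_reduce
        rw [c.2, map_add, hθ]⟩
      map_add' c d := Subtype.ext (funext fun q => map_add θ _ _)
      map_smul' r c := Subtype.ext (funext fun q => map_smul θ _ _) }
  have hzero (c : ρ.Z1) (hc : ∀ q, θ (c.1 q) = 0) : c.1 ∈ ρ.B1 := by
    have hW (q) (a) (ha : a ∈ LinearMap.range L) : ρ q a ∈ LinearMap.range L := by
      rw [← hker, hθ, (hker a).2 ha, map_zero]
    -- A cocycle killed by `θ` takes values in the image of `L`; it lifts to the acyclic `C`, is a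
    -- coboundary there, and this is pushed forward again.
    obtain ⟨b, hb, hbc⟩ := hΓ C (LinearMap.range L) σ (ρ.onSubmodule _ hW)
      L.rangeRestrict (fun q f => Subtype.ext (hL q f)) L.surjective_rangeRestrict
      (fun q => ⟨c.1 q, (hker _).1 (hc q)⟩) (fun q r => Subtype.ext (c.2 q r))
    obtain ⟨m, hm⟩ := (mem_B1 _).1 (hσ b hb)
    refine (mem_B1 _).2 ⟨L m, fun q => ?_⟩
    have hbq : L (b q) = c.1 q := congrArg Subtype.val (hbc q)
    rw [← hbq, hm, map_sub, hL]
  refine HOne.nonempty_equiv F ?_ ?_ ?_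
  · intro c hc
    obtain ⟨a, ha⟩ := (mem_B1 _).1 hc
    refine (mem_B1 _).2 ⟨θ a, fun q => ?_⟩
    change θ (c.1 q) = _
    rw [ha, map_sub, hθ]
  · intro c hc
    obtain ⟨b, hb⟩ := (mem_B1 _).1 hc
    obtain ⟨f, rfl⟩ := hsurj b
    have hd : ρ.coboundary f ∈ ρ.B1 := ⟨f, rfl⟩
    have h := hzero (c - ⟨_, B1_le_Z1 _ hd⟩) fun q => by
      change θ (c.1 q - (ρ q f - f)) = 0
      have h : θ (c.1 q) = τ q (θ f) - θ f := hb q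
      rw [map_sub, h, map_sub, hθ, sub_self]
    have h2 := add_mem h hd
    change c.1 - _ + _ ∈ _ at h2
    rwa [sub_add_cancel] at h2
  · intro w
    obtain ⟨b, hb, hbw⟩ := hΓ _ _ ρ τ θ hθ hsurj w.1 w.2
    refine ⟨⟨b, hb⟩, ?_⟩
    have : w.1 - (F ⟨b, hb⟩).1 = 0 := funext fun q => sub_eq_zero.2 (hbw q).symm
    rw [this]
    exact zero_mem _

end LiftsCocycles

end Representation

/-! ### Split extensions and inflation-restriction in degree one. -/

open Representation

/-- A group `G` presented as a semidirect product of `N` and `Γ`; every element is uniquely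
`s q * j n`. -/
structure SplitExt (G Γ N : Type) [Group G] [Group Γ] [Group N] where
  /-- The section. -/
  s : Γ →* G
  /-- The projection to the quotient. -/
  π : G →* Γ
  /-- The inclusion of the kernel. -/
  j : N →* G
  /-- The kernel coordinate. -/
  p : G → N
  /-- The conjugation action. -/
  conj : Γ →* MulAut N
  π_s : ∀ q, π (s q) = q
  π_j : ∀ n, π (j n) = 1
  p_s : ∀ q, p (s q) = 1
  p_mul_j : ∀ x n, p (x * j n) = p x * n
  s_mul_j_p : ∀ x, s (π x) * j (p x) = x
  s_mul_j : ∀ q n, s q * j n = j (conj q n) * s q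

namespace SplitExt

variable {k G Γ N A : Type} [CommRing k] [Group G] [Group Γ] [Group N]
  [AddCommGroup A] [Module k A] (E : SplitExt G Γ N) (ρ : Representation k G A)

lemma j_mul_s (q : Γ) (n : N) : E.j n * E.s q = E.s q * E.j (E.conj q⁻¹ n) := by
  rw [E.s_mul_j, ← MulAut.mul_apply, ← map_mul, mul_inv_cancel, map_one, MulAut.one_apply]

lemma p_j (n : N) : E.p (E.j n) = n := by
  have h := E.p_mul_j 1 n
  rw [one_mul] at h
  rw [h, ← map_one E.s, E.p_s, one_mul]

lemma p_mul (x y : G) : E.p (x * y) = E.conj (E.π y)⁻¹ (E.p x) * E.p y := by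
  conv_lhs => rw [← E.s_mul_j_p x, ← E.s_mul_j_p y]
  rw [mul_assoc, ← mul_assoc (E.j _), E.j_mul_s, ← mul_assoc, E.p_mul_j, ← mul_assoc, ← map_mul,
    E.p_mul_j, E.p_s, one_mul]

/-- Restriction to the kernel. -/
abbrev resN : Representation k N A := MonoidHom.comp ρ E.j

/-- Restriction along the section. -/
abbrev resΓ : Representation k Γ A := MonoidHom.comp ρ E.s

/-- The action of the quotient on functions on the kernel. -/
def conjFun : Representation k Γ (N → A) where
  toFun q := LinearMap.pi fun n => ρ (E.s q) ∘ₗ LinearMap.proj (E.conj q⁻¹ n)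
  map_one' := by ext; simp
  map_mul' q r := by
    refine LinearMap.ext fun f => funext fun n => ?_
    simp

@[simp]
lemma conjFun_apply (q : Γ) (f : N → A) (n : N) :
    E.conjFun ρ q f n = ρ (E.s q) (f (E.conj q⁻¹ n)) := rfl

lemma ρ_j_s (q : Γ) (n : N) (a : A) :
    ρ (E.s q) (ρ (E.j (E.conj q⁻¹ n)) a) = ρ (E.j n) (ρ (E.s q) a) := by
  rw [← Module.End.mul_apply, ← Module.End.mul_apply, ← map_mul, ← map_mul, E.j_mul_s]

lemma conjFun_mem_Z1 (q : Γ) (z : N → A) (hz : z ∈ (E.resN ρ).Z1) :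
    E.conjFun ρ q z ∈ (E.resN ρ).Z1 := by
  intro m n
  have h := hz (E.conj q⁻¹ m) (E.conj q⁻¹ n)
  simp only [conjFun_apply, map_mul, h, map_add]
  simp only [MonoidHom.comp_apply, E.ρ_j_s]

lemma conjFun_mem_B1 (q : Γ) (z : N → A) (hz : z ∈ (E.resN ρ).B1) :
    E.conjFun ρ q z ∈ (E.resN ρ).B1 := by
  obtain ⟨a, ha⟩ := (mem_B1 _).1 hz
  refine (mem_B1 _).2 ⟨ρ (E.s q) a, fun n => ?_⟩
  rw [conjFun_apply, ha, map_sub]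
  simp only [MonoidHom.comp_apply, E.ρ_j_s]

/-- The action of the quotient on the cocycles of the kernel. -/
abbrev conjZ1 : Representation k Γ (E.resN ρ).Z1 :=
  (E.conjFun ρ).onSubmodule _ (E.conjFun_mem_Z1 ρ)

/-- The action of the quotient on the coboundaries of the kernel. -/
abbrev conjB1 : Representation k Γ (E.resN ρ).B1 :=
  (E.conjFun ρ).onSubmodule _ (E.conjFun_mem_B1 ρ)

/-- The invariants of the kernel, as a submodule. -/
def inv : Submodule k A where
  carrier := {a | ∀ n, ρ (E.j n) a = a}
  zero_mem' n := map_zero _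
  add_mem' {a b} ha hb n := by rw [map_add, ha, hb]
  smul_mem' r a ha n := by rw [map_smul, ha]

lemma mem_inv {a : A} : a ∈ E.inv ρ ↔ ∀ n, ρ (E.j n) a = a := Iff.rfl

lemma s_mem_inv (q : Γ) (a : A) (ha : a ∈ E.inv ρ) : ρ (E.s q) a ∈ E.inv ρ := by
  intro n
  rw [← E.ρ_j_s, (E.mem_inv ρ).1 ha]

/-- The action of the quotient on the invariants of the kernel. -/
abbrev invRep : Representation k Γ (E.inv ρ) := (E.resΓ ρ).onSubmodule _ (E.s_mem_inv ρ)

/-- The first cohomology of the quotient in the invariants of the kernel. -/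
abbrev InvHOne : Type := HOne (A := E.inv ρ) (E.invRep ρ)

variable {ρ} in
lemma ρ_of_mem_inv {a : A} (ha : a ∈ E.inv ρ) (x : G) : ρ x a = ρ (E.s (E.π x)) a := by
  conv_lhs => rw [← E.s_mul_j_p x, map_mul, Module.End.mul_apply, (E.mem_inv ρ).1 ha]

/-- Inflation of cocycles. -/
def inflate : (E.invRep ρ).Z1 →ₗ[k] ρ.Z1 where
  toFun c := ⟨fun x => (c.1 (E.π x)).1, fun x y => by
    beta_reduce
    rw [map_mul, c.2, E.ρ_of_mem_inv (c.1 (E.π y)).2]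
    rfl⟩
  map_add' c d := rfl
  map_smul' r c := rfl

@[simp]
lemma inflate_apply (c : (E.invRep ρ).Z1) (x : G) : (E.inflate ρ c).1 x = (c.1 (E.π x)).1 := rfl

lemma inflate_mem_B1_iff (c : (E.invRep ρ).Z1) :
    (E.inflate ρ c).1 ∈ ρ.B1 ↔ c.1 ∈ (E.invRep ρ).B1 := by
  rw [mem_B1, mem_B1]
  constructor
  · rintro ⟨a, ha⟩
    have hinv : a ∈ E.inv ρ := fun n => by
      have h := ha (E.j n)
      rw [inflate_apply, E.π_j, Z1_map_one c.2] at h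
      exact (sub_eq_zero.1 h.symm)
    refine ⟨⟨a, hinv⟩, fun q => Subtype.ext ?_⟩
    have h := ha (E.s q)
    rw [inflate_apply, E.π_s] at h
    exact h
  · rintro ⟨a, ha⟩
    refine ⟨a.1, fun x => ?_⟩
    rw [inflate_apply, ha, E.ρ_of_mem_inv a.2]
    rfl

/-- Exactness of inflation-restriction in the middle: after subtracting a coboundary the cocycle
vanishes on the kernel, so it factors through the quotient and has invariant values. -/
lemma exists_inflate (z : ρ.Z1) (hz : (fun n => z.1 (E.j n)) ∈ (E.resN ρ).B1) :
    ∃ c : (E.invRep ρ).Z1, z.1 - (E.inflate ρ c).1 ∈ ρ.B1 := by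
  obtain ⟨a, ha⟩ := (mem_B1 _).1 hz
  obtain ⟨w, hw⟩ : ∃ w, w = z.1 - ρ.coboundary a := ⟨_, rfl⟩
  have hwZ : w ∈ ρ.Z1 := hw ▸ sub_mem z.2 (ρ.B1_le_Z1 ⟨a, rfl⟩)
  have hwj (n : N) : w (E.j n) = 0 := by
    rw [hw]
    exact sub_eq_zero.2 (ha n)
  have hright (x : G) (n : N) : w (x * E.j n) = w x := by rw [hwZ, hwj, map_zero, add_zero]
  have hinv (q : Γ) : w (E.s q) ∈ E.inv ρ := fun n => by
    have h := hwZ (E.j n) (E.s q)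
    rw [hwj, zero_add, E.j_mul_s, hright] at h
    exact h.symm
  refine ⟨⟨fun q => ⟨w (E.s q), hinv q⟩, fun q r => Subtype.ext ?_⟩, ?_⟩
  · change w (E.s (q * r)) = w (E.s q) + ρ (E.s q) (w (E.s r))
    rw [map_mul, hwZ]
  · refine (mem_B1 _).2 ⟨a, fun x => ?_⟩
    change z.1 x - w (E.s (E.π x)) = _
    rw [← hright _ (E.p x), E.s_mul_j_p, hw]
    simp

/-- An invariant class of cocycles on the kernel extends to the whole group. -/
lemma exists_extension (hΓ : LiftsCocycles k Γ) (z : N → A) (hz : z ∈ (E.resN ρ).Z1)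
    (hinv : ∀ q, E.conjFun ρ q z - z ∈ (E.resN ρ).B1) :
    ∃ w ∈ ρ.Z1, ∀ n, w (E.j n) = z n := by
  -- The differences `q·z - z` form a cocycle of `Γ` in the coboundaries of `N`, which are a
  -- quotient of `A`. Lifting it to `A` removes the obstruction to extending `z`.
  obtain ⟨a, ha, haz⟩ := hΓ A (E.resN ρ).B1 (E.resΓ ρ) (E.conjB1 ρ)
    (LinearMap.rangeRestrict (E.resN ρ).coboundary)
    (fun q b => by
      refine Subtype.ext (funext fun n => ?_)
      change ρ (E.j n) (ρ (E.s q) b) - ρ (E.s q) b = ρ (E.s q) (ρ (E.j (E.conj q⁻¹ n)) b - b)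
      rw [map_sub, E.ρ_j_s])
    (LinearMap.surjective_rangeRestrict _) (fun q => ⟨_, hinv q⟩)
    (fun q r => by
      refine Subtype.ext ?_
      change E.conjFun ρ (q * r) z - z = (E.conjFun ρ q z - z) +
        E.conjFun ρ q (E.conjFun ρ r z - z)
      rw [map_mul, Module.End.mul_apply, map_sub]
      abel)
  have haz' (q : Γ) (n : N) :
      ρ (E.s q) (z (E.conj q⁻¹ n)) = z n + (ρ (E.j n) (a q) - a q) := by
    have h : ρ (E.j n) (a q) - a q = ρ (E.s q) (z (E.conj q⁻¹ n)) - z n :=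
      congrFun (congrArg Subtype.val (haz q)) n
    rw [h]
    abel
  -- The cocycle rule for `x = s q * j n` forces this formula once the values on the section are `a`
  -- and those on the kernel are `z`.
  refine ⟨fun x => a (E.π x) + ρ (E.s (E.π x)) (z (E.p x)), fun x y => ?_, fun n => ?_⟩
  · beta_reduce
    have h1 : ρ x = ρ (E.s (E.π x)) * ρ (E.j (E.p x)) := by rw [← map_mul, E.s_mul_j_p]
    rw [E.p_mul, hz, map_mul, ha, map_mul, map_mul, h1]
    simp only [Module.End.mul_apply, map_add, haz', MonoidHom.comp_apply, E.ρ_j_s, map_sub]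
    abel
  · beta_reduce
    rw [E.π_j, Z1_map_one ha, E.p_j]
    simp

/-! ### Invariants of the shift and the first cohomology of the kernel. -/

section ShiftInvariants

-- Invariance in the shift amounts to a cocycle rule for right multiplication by the kernel; this is
-- what makes restriction to `N` a cocycle.
variable {ρ} in
lemma shift_inv_apply {f : shiftV k G A} (hf : f ∈ E.inv ρ.shift) (x : G) (n : N) :
    f (x * E.j n) = f x + ρ x (f (E.j n)) := by
  have h : f (x * E.j n) - ρ x (f (E.j n)) = f x := DFunLike.congr_fun (hf n) x
  rw [← h]
  abel

/-- Restriction of an invariant element of the shift to a cocycle on the kernel. -/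
def shiftInvToZ1 : E.inv ρ.shift →ₗ[k] (E.resN ρ).Z1 where
  toFun f := ⟨fun n => f.1 (E.j n), fun m n => by
    beta_reduce
    rw [map_mul, E.shift_inv_apply f.2]
    rfl⟩
  map_add' f g := rfl
  map_smul' r f := rfl

@[simp]
lemma shiftInvToZ1_apply (f : E.inv ρ.shift) (n : N) :
    (E.shiftInvToZ1 ρ f).1 n = f.1 (E.j n) := rfl

lemma shiftInvToZ1_surjective : Function.Surjective (E.shiftInvToZ1 ρ) := by
  intro z
  have hz1 : z.1 1 = 0 := Z1_map_one z.2
  -- Extension by zero on the section. Only invariance under the kernel is needed, so this need not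
  -- be a cocycle on `G`.
  let f : shiftV k G A := ⟨fun x => ρ (E.s (E.π x)) (z.1 (E.p x)), by
    have h1 : E.p 1 = 1 := by rw [← map_one E.s, E.p_s]
    simp [mem_shiftV, h1, hz1]⟩
  have hfj (n : N) : f (E.j n) = z.1 n := by
    change ρ (E.s (E.π (E.j n))) (z.1 (E.p (E.j n))) = _
    rw [E.π_j, E.p_j]
    simp
  refine ⟨⟨f, fun n => shiftV_ext fun x => ?_⟩, Subtype.ext (funext hfj)⟩
  change f (x * E.j n) - ρ x (f (E.j n)) = f x
  rw [hfj]
  change ρ (E.s (E.π (x * E.j n))) (z.1 (E.p (x * E.j n))) - _ = ρ (E.s (E.π x)) (z.1 (E.p x))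
  rw [E.p_mul_j, map_mul, E.π_j, mul_one, z.2, map_add, sub_eq_iff_eq_add]
  have hx : ρ (E.s (E.π x)) (ρ (E.j (E.p x)) (z.1 n)) = ρ x (z.1 n) := by
    rw [← Module.End.mul_apply, ← map_mul, E.s_mul_j_p]
  rw [← hx]
  rfl

/-- Restriction commutes with `Γ` only up to a coboundary, which is enough for a genuine equivariant
map to the cohomology of `N`. -/
lemma shiftInvToZ1_equivariant (q : Γ) (f : E.inv ρ.shift) :
    E.conjZ1 ρ q (E.shiftInvToZ1 ρ f) - E.shiftInvToZ1 ρ (E.invRep ρ.shift q f) =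
      ⟨(E.resN ρ).coboundary (f.1 (E.s q)), (E.resN ρ).B1_le_Z1 ⟨_, rfl⟩⟩ := by
  refine Subtype.ext (funext fun n => ?_)
  change ρ (E.s q) (f.1 (E.j (E.conj q⁻¹ n))) - (f.1 (E.j n * E.s q) - ρ (E.j n) (f.1 (E.s q))) =
    ρ (E.j n) (f.1 (E.s q)) - f.1 (E.s q)
  rw [E.j_mul_s, E.shift_inv_apply f.2]
  abel

/-- Functions on the quotient give invariant elements of the shift. -/
def toShiftInv : (Γ → A) →ₗ[k] E.inv ρ.shift :=
  LinearMap.codRestrict _ (ρ.toShift ∘ₗ LinearMap.funLeft k A E.π) fun f n => by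
    refine shiftV_ext fun x => ?_
    change f (E.π (x * E.j n)) - ρ (x * E.j n) (f (E.π 1)) -
      ρ x (f (E.π (E.j n)) - ρ (E.j n) (f (E.π 1))) = f (E.π x) - ρ x (f (E.π 1))
    rw [map_mul, E.π_j, mul_one, map_one, map_mul, Module.End.mul_apply, map_sub]
    abel

lemma toShiftInv_apply (f : Γ → A) (x : G) :
    (E.toShiftInv ρ f).1 x = f (E.π x) - ρ x (f 1) := by
  change f (E.π x) - ρ x (f (E.π 1)) = _
  rw [map_one]

lemma toShiftInv_equivariant (q : Γ) (f : Γ → A) :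
    E.toShiftInv ρ (rightRegular (k := k) q f) = E.invRep ρ.shift q (E.toShiftInv ρ f) := by
  refine Subtype.ext (shiftV_ext fun x => ?_)
  change _ = (E.toShiftInv ρ f).1 (x * E.s q) - ρ x ((E.toShiftInv ρ f).1 (E.s q))
  rw [toShiftInv_apply, toShiftInv_apply, toShiftInv_apply]
  simp [E.π_s]

/-- Exactness of $(\Gamma\to A)\to(A')^N\to H^1(N,A)$. If `f` restricts to the coboundary of `a`,
then correcting `f` by `x ↦ ρ x a` makes it a function of `π x` alone. -/
lemma mem_range_toShiftInv (f : E.inv ρ.shift) :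
    f ∈ LinearMap.range (E.toShiftInv ρ) ↔ (E.shiftInvToZ1 ρ f).1 ∈ (E.resN ρ).B1 := by
  constructor
  · rintro ⟨f, rfl⟩
    refine (mem_B1 _).2 ⟨-f 1, fun n => ?_⟩
    rw [shiftInvToZ1_apply, toShiftInv_apply, E.π_j, map_neg]
    change _ = -ρ (E.j n) (f 1) - -f 1
    abel
  · intro h
    obtain ⟨a, ha⟩ := (mem_B1 _).1 h
    refine ⟨fun q => f.1 (E.s q) - ρ (E.s q) a, Subtype.ext (shiftV_ext fun x => ?_)⟩
    have hx := E.shift_inv_apply f.2 (E.s (E.π x)) (E.p x)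
    have h := ha (E.p x)
    rw [shiftInvToZ1_apply] at h
    rw [h, E.s_mul_j_p, map_sub] at hx
    have hx2 : ρ (E.s (E.π x)) (ρ (E.j (E.p x)) a) = ρ x a := by
      rw [← Module.End.mul_apply, ← map_mul, E.s_mul_j_p]
    rw [toShiftInv_apply, hx]
    simp only [map_one, shiftV_one, Module.End.one_apply, zero_sub, map_neg,
      MonoidHom.comp_apply, hx2]
    abel

variable {B : Type} [AddCommGroup B] [Module k B] (τ : Representation k Γ B)

/-- The first cohomology of the quotient in the invariants of the shift is its first cohomology
in the first cohomology of the kernel. -/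
theorem nonempty_invHOne_shift_equiv (hΓ : LiftsCocycles k Γ)
    (Θ : (E.resN ρ).Z1 →ₗ[k] B) (hequi : ∀ q z, Θ (E.conjZ1 ρ q z) = τ q (Θ z))
    (hsurj : Function.Surjective Θ) (hker : ∀ z, Θ z = 0 ↔ z.1 ∈ (E.resN ρ).B1) :
    Nonempty (E.InvHOne ρ.shift ≃ₗ[k] τ.HOne) := by
  have hθ (q : Γ) (f : E.inv ρ.shift) : Θ (E.shiftInvToZ1 ρ (E.invRep ρ.shift q f)) =
      τ q (Θ (E.shiftInvToZ1 ρ f)) := by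
    rw [← hequi]
    refine (sub_eq_zero.1 ?_).symm
    rw [← map_sub, E.shiftInvToZ1_equivariant]
    exact (hker _).2 ⟨_, rfl⟩
  have hk (f : E.inv ρ.shift) :
      Θ (E.shiftInvToZ1 ρ f) = 0 ↔ f ∈ LinearMap.range (E.toShiftInv ρ) :=
    (hker _).trans (E.mem_range_toShiftInv ρ f).symm
  have h := HOne.nonempty_equiv_of_surjective (A := E.inv ρ.shift) (C := Γ → A) hΓ (E.invRep ρ.shift)
    τ (rightRegular (k := k)) (Θ ∘ₗ E.shiftInvToZ1 ρ) (E.toShiftInv ρ) hθ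
    (hsurj.comp (E.shiftInvToZ1_surjective ρ)) (E.toShiftInv_equivariant ρ) hk
    (fun z hz => mem_B1_rightRegular hz)
  exact h

end ShiftInvariants

end SplitExt

/-! ### Difference equations along an infinite cyclic subgroup. -/

section Translation

variable {k G A : Type} [CommRing k] [Group G] [AddCommGroup A] [Module k A]

/-- Discrete primitives on the integers. -/
lemma Int.exists_primitive (u : ℤ → A) : ∃ S : ℤ → A, ∀ n, S (n + 1) = S n + u n := by
  -- A signed sum: for each `n` at least one of the two intervals is empty.
  refine ⟨fun n => ∑ i ∈ Finset.Ico 0 n, u i - ∑ i ∈ Finset.Ico n 0, u i, fun n => ?_⟩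
  rcases le_or_gt 0 n with h | h
  · have h1 : Finset.Ico n 0 = ∅ := Finset.Ico_eq_empty (by lia)
    have h2 : Finset.Ico (n + 1) 0 = ∅ := Finset.Ico_eq_empty (by lia)
    have h3 : Finset.Ico 0 (n + 1) = insert n (Finset.Ico 0 n) := by ext; simp; lia
    simp only [h1, h2, h3]
    rw [Finset.sum_insert (by simp)]
    simp
    abel
  · have h1 : Finset.Ico 0 n = ∅ := Finset.Ico_eq_empty (by lia)
    have h2 : Finset.Ico 0 (n + 1) = ∅ := Finset.Ico_eq_empty (by lia)
    have h3 : Finset.Ico n 0 = insert n (Finset.Ico (n + 1) 0) := by ext; simp; lia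
    simp only [h1, h2, h3]
    rw [Finset.sum_insert (by simp)]
    simp

/-- The difference operator of a translation of infinite order is surjective on functions. -/
lemma exists_translate_sub_eq (e : G) (a : G → ℤ) (ha : ∀ x, a (x * e) = a x + 1) (u : G → A) :
    ∃ f : G → A, (∀ x, f (x * e) = f x + u x) ∧
      ∀ g, Commute g e → (∀ x, a (x * g) = a x) → (∀ x, u (x * g) = u x) →
        ∀ x, f (x * g) = f x := by
  choose S hS using fun v : ℤ → A => Int.exists_primitive v
  -- Each coset of `⟨e⟩` is parametrised by the coordinate `a`. The sequence fed to `S` depends only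
  -- on the coset, so a single choice of primitive serves all of it.
  refine ⟨fun x => S (fun i => u (x * e ^ (i - a x))) (a x), fun x => ?_, fun g hg hag hug x => ?_⟩
  · have h : (fun i => u (x * e * e ^ (i - a (x * e)))) = fun i => u (x * e ^ (i - a x)) := by
      funext i
      rw [ha, mul_assoc, ← zpow_one_add]
      congr 3
      ring
    beta_reduce
    rw [h, ha, hS]
    simp
  · have h : (fun i => u (x * g * e ^ (i - a (x * g)))) = fun i => u (x * e ^ (i - a x)) := by
      funext i
      rw [hag, mul_assoc, (hg.zpow_right _).eq, ← mul_assoc, hug]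
    beta_reduce
    rw [h, hag]

/-- A translation of infinite order has surjective difference operator on the shift. -/
lemma Representation.exists_shift_sub_eq (ρ : Representation k G A) (e : G) (a : G → ℤ)
    (ha : ∀ x, a (x * e) = a x + 1) (u : shiftV k G A) :
    ∃ f : shiftV k G A, f e = 0 ∧ ρ.shift e f - f = u := by
  obtain ⟨f, hf, -⟩ := exists_translate_sub_eq e a ha u
  have h1 := hf 1
  rw [one_mul, shiftV_one, add_zero] at h1
  refine ⟨⟨fun x => f x - f 1, sub_self _⟩, ?_, shiftV_ext fun x => ?_⟩
  · exact sub_eq_zero.2 h1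
  · change f (x * e) - f 1 - ρ x (f e - f 1) - (f x - f 1) = u x
    rw [h1, hf, sub_self, map_zero]
    abel

end Translation

/-! ### Cohomology of the rank-two lattice in a shift. -/

/-- The standard basis of the free abelian group of rank two, written multiplicatively. -/
def stdGen (i : Fin 2) : Multiplicative (Fin 2 → ℤ) := Multiplicative.ofAdd (Pi.single i 1)

lemma eq_stdGen_zpow (n : Multiplicative (Fin 2 → ℤ)) :
    n = stdGen 0 ^ (n.toAdd 0) * stdGen 1 ^ (n.toAdd 1) := by
  refine Multiplicative.toAdd.injective (funext fun i => ?_)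
  fin_cases i <;> simp [stdGen]

lemma Representation.Z1_eq_zero_of_stdGen {k A : Type} [CommRing k] [AddCommGroup A] [Module k A]
    {ρ : Representation k (Multiplicative (Fin 2 → ℤ)) A} {z : Multiplicative (Fin 2 → ℤ) → A}
    (hz : z ∈ ρ.Z1) (h : ∀ i, z (stdGen i) = 0) : z = 0 := by
  let K : Subgroup (Multiplicative (Fin 2 → ℤ)) :=
    { carrier := {n | z n = 0}
      one_mem' := Z1_map_one hz
      mul_mem' {a b} ha hb := by
        change z (a * b) = 0
        rw [hz, show z a = 0 from ha, show z b = 0 from hb, map_zero, add_zero]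
      inv_mem' {a} ha := by
        change z a⁻¹ = 0
        rw [Z1_map_inv hz, show z a = 0 from ha, map_zero, neg_zero] }
  funext n
  have hn : n ∈ K := by
    rw [eq_stdGen_zpow n]
    exact K.mul_mem (K.zpow_mem (h 0) _) (K.zpow_mem (h 1) _)
  exact hn

namespace SplitExt

variable {k G Γ A : Type} [CommRing k] [Group G] [Group Γ] [AddCommGroup A] [Module k A]
  (E : SplitExt G Γ (Multiplicative (Fin 2 → ℤ))) (ρ : Representation k G A)

/-- The images of the standard generators. -/
def gen (i : Fin 2) : G := E.j (stdGen i)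

/-- The integral coordinates of the kernel part. -/
def coord (i : Fin 2) (x : G) : ℤ := (E.p x).toAdd i

lemma coord_mul_gen (i : Fin 2) (x : G) : E.coord i (x * E.gen i) = E.coord i x + 1 := by
  simp [coord, gen, E.p_mul_j, stdGen]

lemma coord_mul_gen_of_ne {i l : Fin 2} (h : i ≠ l) (x : G) :
    E.coord i (x * E.gen l) = E.coord i x := by
  simp [coord, gen, E.p_mul_j, stdGen, h]

lemma commute_gen (i l : Fin 2) : Commute (E.gen i) (E.gen l) :=
  (Commute.all (stdGen i) (stdGen l)).map E.j

/-- The class of `z` stands for one in $H^2(\mathbb Z^2,A)$, and the two generators are treated in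
turn. Killing `z` on the first leaves an invariant value on the second, whose obstruction lies in
$H^1(\mathbb Z,A)$ and is represented by the commutator term. -/
lemma mem_B1_shift_of_commutator {z : Multiplicative (Fin 2 → ℤ) → shiftV k G A}
    (hz : z ∈ (E.resN ρ.shift).Z1)
    (h : ∃ b, z (stdGen 1) (E.gen 0) - z (stdGen 0) (E.gen 1) = ρ (E.gen 0) b - b) :
    z ∈ (E.resN ρ.shift).B1 := by
  obtain ⟨b, hb⟩ := h
  -- Normalising `f` to vanish at `gen 0` simplifies the comparison of the obstruction with the
  -- commutator term below.
  obtain ⟨f, hf0, hf⟩ := ρ.exists_shift_sub_eq (E.gen 0) _ (E.coord_mul_gen 0) (z (stdGen 0))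
  obtain ⟨z', hz'⟩ : ∃ z', z' = z - (E.resN ρ.shift).coboundary f := ⟨_, rfl⟩
  have hz'Z : z' ∈ (E.resN ρ.shift).Z1 := hz' ▸ sub_mem hz (B1_le_Z1 _ ⟨f, rfl⟩)
  have h0 : z' (stdGen 0) = 0 := by
    rw [hz', Pi.sub_apply, ← hf]
    exact sub_self _
  have hv1 : ρ.shift (E.gen 0) (z' (stdGen 1)) = z' (stdGen 1) := by
    have h1 := hz'Z (stdGen 0) (stdGen 1)
    rw [mul_comm, hz'Z, h0, map_zero, add_zero, zero_add] at h1
    exact h1.symm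
  obtain ⟨v, hv⟩ : ∃ v, v = z' (stdGen 1) := ⟨_, rfl⟩
  rw [← hv] at hv1
  have hvx (x : G) : v (x * E.gen 0) = v x + ρ x (v (E.gen 0)) := by
    have h1 : v (x * E.gen 0) - ρ x (v (E.gen 0)) = v x := DFunLike.congr_fun hv1 x
    rw [← h1]
    abel
  have hve : ∃ b', v (E.gen 0) = ρ (E.gen 0) b' - b' := by
    have h1 : v (E.gen 0) = z (stdGen 1) (E.gen 0) -
        ((f (E.gen 0 * E.gen 1) - ρ (E.gen 0) (f (E.gen 1))) - f (E.gen 0)) := by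
      rw [hv, hz']
      rfl
    have h2 : (f (E.gen 1 * E.gen 0) - ρ (E.gen 1) (f (E.gen 0))) - f (E.gen 1) =
        z (stdGen 0) (E.gen 1) := DFunLike.congr_fun hf (E.gen 1)
    refine ⟨b + f (E.gen 1), ?_⟩
    rw [hf0, map_zero, sub_zero, (E.commute_gen 1 0).eq] at h2
    rw [h1, hf0, sub_zero, map_add]
    rw [← h2] at hb
    rw [add_sub_add_comm, ← hb]
    abel
  obtain ⟨b', hb'⟩ := hve
  -- Subtracting `ρ x b'` represents the same class in the shift by a function that is honestly
  -- invariant under `gen 0`. A primitive along `gen 1` can then be kept invariant under `gen 0`.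
  obtain ⟨g, hg, hg0⟩ := exists_translate_sub_eq (E.gen 1) _ (E.coord_mul_gen 1)
    (fun x => v x - ρ x b')
  replace hg0 := hg0 (E.gen 0) (E.commute_gen 0 1) (E.coord_mul_gen_of_ne (by decide))
    fun x => by
      rw [hvx, hb', map_mul, map_sub, Module.End.mul_apply]
      abel
  obtain ⟨w, hw⟩ : ∃ w, w = f + ρ.toShift g := ⟨_, rfl⟩
  have hzero : z' - (E.resN ρ.shift).coboundary (ρ.toShift g) = 0 := by
    refine Z1_eq_zero_of_stdGen (sub_mem hz'Z (B1_le_Z1 _ ⟨_, rfl⟩)) fun i => ?_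
    fin_cases i
    · change z' (stdGen 0) - (ρ.shift (E.gen 0) (ρ.toShift g) - ρ.toShift g) = 0
      rw [h0]
      refine shiftV_ext fun x => ?_
      have h1 := hg0 1
      rw [one_mul] at h1
      simp [hg0, h1]
    · change z' (stdGen 1) - (ρ.shift (E.gen 1) (ρ.toShift g) - ρ.toShift g) = 0
      rw [← hv]
      refine shiftV_ext fun x => ?_
      have h1 := hg 1
      rw [one_mul] at h1
      simp [hg, h1]
      abel
  refine ⟨f + ρ.toShift g, ?_⟩
  rw [map_add, ← sub_eq_zero.1 hzero, hz']
  abel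

/-- This is $H^3(\mathbb Z^2,A)=0$: on a shift the difference operator of `gen 0` is onto, so the
commutator condition is automatic. -/
lemma mem_B1_shift_shift {z : Multiplicative (Fin 2 → ℤ) → shiftV k G (shiftV k G A)}
    (hz : z ∈ (E.resN ρ.shift.shift).Z1) : z ∈ (E.resN ρ.shift.shift).B1 := by
  refine E.mem_B1_shift_of_commutator ρ.shift hz ?_
  obtain ⟨b, -, hb⟩ := ρ.exists_shift_sub_eq (E.gen 0) _ (E.coord_mul_gen 0)
    (z (stdGen 1) (E.gen 0) - z (stdGen 0) (E.gen 1))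
  exact ⟨b, hb.symm⟩

end SplitExt

lemma map_eq_of_map_mul_eq_add (f : Multiplicative (Fin 2 → ℤ) → ℤ)
    (hf : ∀ m n, f (m * n) = f m + f n) (n : Multiplicative (Fin 2 → ℤ)) :
    f n = n.toAdd 0 * f (stdGen 0) + n.toAdd 1 * f (stdGen 1) := by
  obtain ⟨φ, hφ⟩ : ∃ φ : Multiplicative (Fin 2 → ℤ) →* Multiplicative ℤ,
      ∀ n, (φ n).toAdd = f n :=
    ⟨MonoidHom.mk' (fun n => Multiplicative.ofAdd (f n)) fun m n => by
      rw [hf, ofAdd_add], fun n => rfl⟩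
  have h : φ n = φ (stdGen 0) ^ (n.toAdd 0) * φ (stdGen 1) ^ (n.toAdd 1) := by
    conv_lhs => rw [eq_stdGen_zpow n]
    simp
  simpa [hφ] using congrArg Multiplicative.toAdd h

namespace SplitExt

variable {G Γ : Type} [Group G] [Group Γ] (E : SplitExt G Γ (Multiplicative (Fin 2 → ℤ)))

/-! ### The commutator pairing and the second cohomology of the lattice. -/

section Pairing

/-- The trivial integral representation. -/
abbrev triv (G : Type) [Group G] : Representation ℤ G ℤ := Representation.trivial ℤ G ℤ

variable {E} in
lemma Z1_shift_triv_mul {z : Multiplicative (Fin 2 → ℤ) → shiftV ℤ G ℤ}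
    (hz : z ∈ (E.resN (triv G).shift).Z1) (m n : Multiplicative (Fin 2 → ℤ)) (x : G) :
    z (m * n) x = z m x + (z n (x * E.j m) - z n (E.j m)) := by
  rw [hz]
  rfl

/-- The commutator pairing of the central extension attached to a cocycle. -/
def pairing (z : Multiplicative (Fin 2 → ℤ) → shiftV ℤ G ℤ)
    (m n : Multiplicative (Fin 2 → ℤ)) : ℤ := z n (E.j m) - z m (E.j n)

lemma pairing_swap (z : Multiplicative (Fin 2 → ℤ) → shiftV ℤ G ℤ)
    (m n : Multiplicative (Fin 2 → ℤ)) : E.pairing z m n = -E.pairing z n m := by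
  simp [pairing]

lemma pairing_mul_right {z : Multiplicative (Fin 2 → ℤ) → shiftV ℤ G ℤ}
    (hz : z ∈ (E.resN (triv G).shift).Z1) (m n n' : Multiplicative (Fin 2 → ℤ)) :
    E.pairing z m (n * n') = E.pairing z m n + E.pairing z m n' := by
  have h1 := Z1_shift_triv_mul hz n n' (E.j m)
  have h2 := Z1_shift_triv_mul hz n' n (E.j m)
  have h3 := Z1_shift_triv_mul hz n m (E.j n')
  have h4 := Z1_shift_triv_mul hz m n (E.j n')
  simp only [pairing, ← map_mul] at *
  rw [mul_comm m n] at h4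
  rw [mul_comm n' n] at h2 h3
  rw [mul_comm n' m] at h4
  linear_combination h2 + h3 - h4

/-- An alternating bilinear form on $\mathbb Z^2$ is a multiple of the determinant. -/
lemma pairing_eq {z : Multiplicative (Fin 2 → ℤ) → shiftV ℤ G ℤ}
    (hz : z ∈ (E.resN (triv G).shift).Z1) (m n : Multiplicative (Fin 2 → ℤ)) :
    E.pairing z m n = (m.toAdd 0 * n.toAdd 1 - m.toAdd 1 * n.toAdd 0) *
      E.pairing z (stdGen 0) (stdGen 1) := by
  have hself (n) : E.pairing z n n = 0 := sub_self _
  have hr (m n) := map_eq_of_map_mul_eq_add (E.pairing z m) (E.pairing_mul_right hz m) n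
  rw [hr, E.pairing_swap z m, E.pairing_swap z m, hr _ m, hr _ m, hself, hself,
    E.pairing_swap z (stdGen 1) (stdGen 0)]
  ring

lemma pairing_conj {z : Multiplicative (Fin 2 → ℤ) → shiftV ℤ G ℤ}
    (hz : z ∈ (E.resN (triv G).shift).Z1) (q : Γ) (m n : Multiplicative (Fin 2 → ℤ)) :
    E.pairing (E.conjFun (triv G).shift q z) m n =
      E.pairing z (E.conj q⁻¹ m) (E.conj q⁻¹ n) := by
  have key (m n) : E.conjFun (triv G).shift q z n (E.j m) =
      z (E.conj q⁻¹ n) (E.j m * E.s q) - z (E.conj q⁻¹ n) (E.s q) := rfl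
  have h1 := Z1_shift_triv_mul hz (E.conj q⁻¹ m) (E.conj q⁻¹ n) (E.s q)
  have h2 := Z1_shift_triv_mul hz (E.conj q⁻¹ n) (E.conj q⁻¹ m) (E.s q)
  rw [pairing, pairing, key, key, E.j_mul_s, E.j_mul_s]
  rw [mul_comm (E.conj q⁻¹ m)] at h1
  linear_combination h2 - h1

/-- The commutator pairing of the generators, as a linear map on cocycles. -/
def commPairing : (E.resN (triv G).shift).Z1 →ₗ[ℤ] ℤ where
  toFun z := E.pairing z.1 (stdGen 0) (stdGen 1)
  map_add' y z := by
    simp only [pairing, Submodule.coe_add, Pi.add_apply, shiftV_add]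
    ring
  map_smul' r z := by
    simp only [pairing, Submodule.coe_smul, Pi.smul_apply, shiftV_smul, smul_eq_mul,
      RingHom.id_apply]
    ring

lemma commPairing_apply (z : (E.resN (triv G).shift).Z1) :
    E.commPairing z = E.pairing z.1 (stdGen 0) (stdGen 1) := rfl

/-- For trivial coefficients the commutator term is the whole obstruction. Conversely, the pairing
of a coboundary is symmetric in its two arguments, hence zero. -/
lemma commPairing_eq_zero_iff (z : (E.resN (triv G).shift).Z1) :
    E.commPairing z = 0 ↔ z.1 ∈ (E.resN (triv G).shift).B1 := by
  constructor
  · intro h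
    exact E.mem_B1_shift_of_commutator _ z.2 ⟨0, h.trans (by simp)⟩
  · intro h
    obtain ⟨f, hf⟩ := (mem_B1 _).1 h
    have key (m n) : z.1 n (E.j m) = f (E.j (m * n)) - f (E.j n) - f (E.j m) := by
      rw [hf, map_mul]
      rfl
    rw [commPairing_apply, pairing, key, key, mul_comm (stdGen 1)]
    ring

lemma commPairing_surjective : Function.Surjective E.commPairing := by
  -- The Heisenberg extension: the bilinear form $m_0n_1$, extended to `G` through the kernel
  -- coordinate.
  let z : Multiplicative (Fin 2 → ℤ) → shiftV ℤ G ℤ := fun n =>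
    ⟨fun x => E.coord 0 x * n.toAdd 1, by
      have h1 : E.p 1 = 1 := by rw [← map_one E.s, E.p_s]
      simp [mem_shiftV, coord, h1]⟩
  have hz : z ∈ (E.resN (triv G).shift).Z1 := fun m n => shiftV_ext fun x => by
    change E.coord 0 x * (m.toAdd 1 + n.toAdd 1) = E.coord 0 x * m.toAdd 1 +
      (E.coord 0 (x * E.j m) * n.toAdd 1 - E.coord 0 (E.j m) * n.toAdd 1)
    simp only [coord, E.p_mul_j, E.p_j, toAdd_mul, Pi.add_apply]
    ring
  have h1 : E.commPairing ⟨z, hz⟩ = 1 := by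
    change E.coord 0 (E.j (stdGen 0)) * (stdGen 1).toAdd 1 -
      E.coord 0 (E.j (stdGen 1)) * (stdGen 0).toAdd 1 = 1
    simp [coord, E.p_j, stdGen]
  intro a
  exact ⟨a • ⟨z, hz⟩, by rw [map_smul, h1, smul_eq_mul, mul_one]⟩

variable (M : Γ →* SL(2, ℤ))
  (hM : ∀ q n, (E.conj q n).toAdd = (M q).1.mulVec n.toAdd)

include hM

/-- Conjugation multiplies a determinant form by the determinant of the action, which is one; so
$\Gamma$ acts trivially on $H^2(N,\mathbb Z)$. -/
lemma commPairing_conj (q : Γ) (z : (E.resN (triv G).shift).Z1) :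
    E.commPairing (E.conjZ1 (triv G).shift q z) = E.commPairing z := by
  rw [commPairing_apply, commPairing_apply]
  refine (E.pairing_conj z.2 q _ _).trans ?_
  rw [E.pairing_eq z.2, hM, hM]
  have hdet := (M q⁻¹).2
  rw [Matrix.det_fin_two] at hdet
  have h : (M q⁻¹).1.mulVec (stdGen 0).toAdd 0 * (M q⁻¹).1.mulVec (stdGen 1).toAdd 1 -
      (M q⁻¹).1.mulVec (stdGen 0).toAdd 1 * (M q⁻¹).1.mulVec (stdGen 1).toAdd 0 = 1 := by
    simp only [stdGen, toAdd_ofAdd, Matrix.mulVec_single_one, Matrix.col_apply]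
    linear_combination hdet
  rw [h, one_mul]

end Pairing

end SplitExt

set_option maxSynthPendingDepth 4

/-! ### Assembling the cohomology of the extension degree by degree. -/

namespace SplitExt

section General

variable {k G Γ N A : Type} [CommRing k] [Group G] [Group Γ] [Group N]
  [AddCommGroup A] [Module k A] (E : SplitExt G Γ N) (ρ : Representation k G A)

/-- Restriction of cocycles to the kernel. -/
def restrictZ1 : ρ.Z1 →ₗ[k] (E.resN ρ).Z1 where
  toFun z := ⟨fun n => z.1 (E.j n), fun m n => by
    beta_reduce
    rw [map_mul, z.2]
    rfl⟩
  map_add' y z := rfl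
  map_smul' r z := rfl

lemma restrictZ1_inflate (c : (E.invRep ρ).Z1) : E.restrictZ1 ρ (E.inflate ρ c) = 0 := by
  refine Subtype.ext (funext fun n => ?_)
  change (c.1 (E.π (E.j n))).1 = 0
  rw [E.π_j, Z1_map_one c.2]
  rfl

lemma restrictZ1_mem_B1 {z : ρ.Z1} (hz : z.1 ∈ ρ.B1) :
    (E.restrictZ1 ρ z).1 ∈ (E.resN ρ).B1 := by
  obtain ⟨a, ha⟩ := (mem_B1 _).1 hz
  exact (mem_B1 _).2 ⟨a, fun n => ha (E.j n)⟩

/-- If the first cohomology of the kernel vanishes then inflation is an isomorphism. -/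
lemma nonempty_invHOne_equiv (h : ∀ z ∈ (E.resN ρ).Z1, z ∈ (E.resN ρ).B1) :
    Nonempty (E.InvHOne ρ ≃ₗ[k] ρ.HOne) :=
  HOne.nonempty_equiv (E.inflate ρ) (fun z hz => (E.inflate_mem_B1_iff ρ z).2 hz)
    (fun z hz => (E.inflate_mem_B1_iff ρ z).1 hz) fun w => by
      obtain ⟨c, hc⟩ := E.exists_inflate ρ w (h _ (E.restrictZ1 ρ w).2)
      exact ⟨c, hc⟩

/-- The inflation map on first cohomology. -/
def inflateHOne : E.InvHOne ρ →ₗ[k] ρ.HOne :=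
  HOne.map (E.inflate ρ) fun z hz => (E.inflate_mem_B1_iff ρ z).2 hz

lemma inflateHOne_injective : Function.Injective (E.inflateHOne ρ) := by
  rw [← LinearMap.ker_eq_bot, LinearMap.ker_eq_bot']
  intro m hm
  obtain ⟨z, rfl⟩ := Submodule.Quotient.mk_surjective _ m
  exact (Submodule.Quotient.mk_eq_zero _).2 ((E.inflate_mem_B1_iff ρ z).1
    ((Submodule.Quotient.mk_eq_zero (ρ.B1.submoduleOf ρ.Z1)).1 hm))

variable (hΓ : LiftsCocycles k Γ)
include hΓ

/-- If the first cohomology of the kernel vanishes, then so does the first cohomology of the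
quotient in the invariants of the shift. -/
lemma subsingleton_invHOne_shift (h : ∀ z ∈ (E.resN ρ).Z1, z ∈ (E.resN ρ).B1) :
    Subsingleton (E.InvHOne ρ.shift) := by
  obtain ⟨e⟩ := E.nonempty_invHOne_shift_equiv ρ (Representation.trivial k Γ PUnit) hΓ
    (0 : (E.resN ρ).Z1 →ₗ[k] PUnit) (fun _ _ => rfl) (fun _ => ⟨0, rfl⟩)
    (fun z => ⟨fun _ => h _ z.2, fun _ => rfl⟩)
  have : Subsingleton (Representation.trivial k Γ PUnit).HOne := by
    refine ⟨fun a b => ?_⟩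
    obtain ⟨a, rfl⟩ := Submodule.Quotient.mk_surjective _ a
    obtain ⟨b, rfl⟩ := Submodule.Quotient.mk_surjective _ b
    exact congrArg _ (Subtype.ext (funext fun _ => rfl))
  exact e.toEquiv.subsingleton

/-- Vanishing of the first cohomology of the kernel in two consecutive shifts gives vanishing of
the first cohomology of the extension in the second one. -/
lemma subsingleton_hOne_shift (h : ∀ z ∈ (E.resN ρ).Z1, z ∈ (E.resN ρ).B1)
    (h' : ∀ z ∈ (E.resN ρ.shift).Z1, z ∈ (E.resN ρ.shift).B1) : Subsingleton ρ.shift.HOne := by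
  obtain ⟨e⟩ := E.nonempty_invHOne_equiv ρ.shift h'
  have := E.subsingleton_invHOne_shift ρ hΓ h
  exact e.symm.toEquiv.subsingleton

end General

lemma nonempty_equiv_prod_of_exact {X Y : Type} [AddCommGroup X] [AddCommGroup Y]
    (f : X →+ Y) (g : Y →+ ℤ) (hf : Function.Injective f)
    (hg : Function.Surjective g) (hfg : ∀ y, g y = 0 ↔ y ∈ Set.range f) :
    Nonempty (Y ≃+ X × ℤ) := by
  obtain ⟨y, hy⟩ := hg 1
  have hgf (x : X) : g (f x) = 0 := (hfg _).2 ⟨x, rfl⟩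
  -- The preimage `y` of `1` splits the sequence.
  let φ : X × ℤ →+ Y := f.coprod (zmultiplesHom Y y)
  have hφ (a : X × ℤ) : φ a = f a.1 + a.2 • y := by simp [φ]
  refine ⟨(AddEquiv.ofBijective φ ⟨?_, ?_⟩).symm⟩
  · rw [injective_iff_map_eq_zero]
    rintro ⟨x, n⟩ h
    rw [hφ] at h
    have hn : n = 0 := by simpa [hgf, hy] using congrArg g h
    subst hn
    rw [zero_smul, add_zero] at h
    exact Prod.ext (hf (h.trans (map_zero f).symm)) rfl
  · intro w
    obtain ⟨x, hx⟩ := (hfg (w - g w • y)).1 (by simp [hy])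
    refine ⟨(x, g w), ?_⟩
    rw [hφ, hx]
    exact sub_add_cancel _ _

variable {G Γ : Type} [Group G] [Group Γ] (E : SplitExt G Γ (Multiplicative (Fin 2 → ℤ)))

lemma B1_triv_eq_bot (G : Type) [Group G] {z : G → ℤ} (hz : z ∈ (triv G).B1) : z = 0 := by
  obtain ⟨a, ha⟩ := (mem_B1 _).1 hz
  funext g
  rw [ha]
  exact sub_self a

section Cohomology

variable (hconj : ∀ φ : Multiplicative (Fin 2 → ℤ) → ℤ, (∀ m n, φ (m * n) = φ m + φ n) →
  (∀ q n, φ (E.conj q n) = φ n) → φ = 0)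

include hconj in
/-- If the kernel has no coinvariants rationally, then the first integral cohomology is that of the
quotient. -/
theorem nonempty_hOne_triv_equiv : Nonempty ((triv G).HOne ≃ₗ[ℤ] (triv Γ).HOne) := by
  let f : (triv Γ).Z1 →ₗ[ℤ] (triv G).Z1 :=
    { toFun z := ⟨fun x => z.1 (E.π x), fun x y => by
        beta_reduce
        rw [map_mul, z.2]
        rfl⟩
      map_add' y z := rfl
      map_smul' r z := rfl }
  refine (HOne.nonempty_equiv (ρ := triv Γ) (σ := triv G) f ?_ ?_ ?_).map LinearEquiv.symm
  · intro z hz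
    have h : (f z).1 = 0 := funext fun x => congrFun (B1_triv_eq_bot Γ hz) (E.π x)
    rw [h]
    exact zero_mem _
  · intro z hz
    have h : z.1 = 0 := funext fun q => by
      have h := congrFun (B1_triv_eq_bot G hz) (E.s q)
      change z.1 (E.π (E.s q)) = 0 at h
      rwa [E.π_s] at h
    rw [h]
    exact zero_mem _
  · intro w
    have hw (x y : G) : w.1 (x * y) = w.1 x + w.1 y := w.2 x y
    -- A homomorphism on `G` restricts to a `Γ`-invariant one on the kernel.
    have hwj : (fun n => w.1 (E.j n)) = 0 := by
      refine hconj _ (fun m n => ?_) fun q n => ?_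
      · rw [map_mul, hw]
      · have h := congrArg w.1 (E.s_mul_j q n)
        rw [hw, hw] at h
        linarith
    refine ⟨⟨fun q => w.1 (E.s q), fun q r => ?_⟩, ?_⟩
    · beta_reduce
      rw [map_mul, hw]
      rfl
    · have h : w.1 - (fun x => w.1 (E.s (E.π x))) = 0 := funext fun x => by
        have h1 : w.1 (E.j (E.p x)) = 0 := congrFun hwj _
        have h2 : w.1 x = w.1 (E.s (E.π x)) := by
          conv_lhs => rw [← E.s_mul_j_p x, hw, h1, add_zero]
        exact sub_eq_zero.2 h2
      change w.1 - (fun x => w.1 (E.s (E.π x))) ∈ _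
      rw [h]
      exact zero_mem _

variable (M : Γ →* SL(2, ℤ))
  (hM : ∀ q n, (E.conj q n).toAdd = (M q).1.mulVec n.toAdd)
  (τ : Representation ℤ Γ (Module.Dual ℤ (Fin 2 → ℤ)))
  (hτ : ∀ q f v, τ q f v = f ((M q⁻¹).1.mulVec v))
  (hΓ : LiftsCocycles ℤ Γ)

-- Here $H^1(N,\mathbb Z)=\mathrm{Hom}(N,\mathbb Z)$ is the dual lattice, since the coboundaries are
-- zero.
include hM hτ hΓ in
lemma nonempty_invHOne_shift_triv_equiv :
    Nonempty (E.InvHOne (triv G).shift ≃ₗ[ℤ] τ.HOne) := by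
  let Θ : (E.resN (triv G)).Z1 →ₗ[ℤ] Module.Dual ℤ (Fin 2 → ℤ) :=
    { toFun z := (AddMonoidHom.mk' (fun v => z.1 (Multiplicative.ofAdd v))
        fun v w => z.2 _ _).toIntLinearMap
      map_add' y z := rfl
      map_smul' r z := rfl }
  have hΘ (z v) : Θ z v = z.1 (Multiplicative.ofAdd v) := rfl
  refine E.nonempty_invHOne_shift_equiv (triv G) τ hΓ Θ ?_ ?_ ?_
  · intro q z
    refine LinearMap.ext fun v => ?_
    rw [hτ, hΘ, hΘ]
    change z.1 (E.conj q⁻¹ (Multiplicative.ofAdd v)) = _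
    exact congrArg z.1 (hM _ _)
  · intro f
    refine ⟨⟨fun n => f n.toAdd, fun m n => ?_⟩, LinearMap.ext fun v => rfl⟩
    beta_reduce
    rw [toAdd_mul, map_add]
    rfl
  · intro z
    constructor
    · intro h
      have hz : z.1 = 0 := funext fun n => LinearMap.congr_fun h n.toAdd
      rw [hz]
      exact zero_mem _
    · intro h
      obtain ⟨a, ha⟩ := (mem_B1 _).1 h
      refine LinearMap.ext fun v => ?_
      rw [hΘ, ha]
      exact sub_self a

include hM hτ hΓ in
/-- The second integral cohomology of the extension, in shifted form. -/
theorem nonempty_hOne_shift_triv_equiv :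
    Nonempty ((triv G).shift.HOne ≃+ τ.HOne × ℤ) := by
  let g₀ : (triv G).shift.Z1 →ₗ[ℤ] ℤ := E.commPairing ∘ₗ E.restrictZ1 (triv G).shift
  have hg₀ (z : (triv G).shift.Z1) (hz : z.1 ∈ (triv G).shift.B1) : g₀ z = 0 :=
    (E.commPairing_eq_zero_iff _).2 (E.restrictZ1_mem_B1 _ hz)
  let g : (triv G).shift.HOne →ₗ[ℤ] ℤ := Submodule.liftQ _ g₀ fun z hz => hg₀ z hz
  obtain ⟨e'⟩ := E.nonempty_invHOne_shift_triv_equiv M hM τ hτ hΓ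
  refine (nonempty_equiv_prod_of_exact (E.inflateHOne (triv G).shift).toAddMonoidHom
    g.toAddMonoidHom
    (E.inflateHOne_injective _) ?_ ?_).map fun e =>
      e.trans (e'.toAddEquiv.prodCongr (AddEquiv.refl ℤ))
  · intro a
    obtain ⟨z, hz⟩ := E.commPairing_surjective a
    -- Every class on the kernel is `Γ`-invariant, so it extends to `G`.
    obtain ⟨w, hw, hwz⟩ := E.exists_extension (triv G).shift hΓ z.1 z.2 fun q => by
      refine (E.commPairing_eq_zero_iff (E.conjZ1 (triv G).shift q z - z)).1 ?_
      rw [map_sub, E.commPairing_conj M hM, sub_self]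
    refine ⟨Submodule.Quotient.mk ⟨w, hw⟩, ?_⟩
    have h : E.restrictZ1 (triv G).shift ⟨w, hw⟩ = z := Subtype.ext (funext hwz)
    change E.commPairing (E.restrictZ1 (triv G).shift ⟨w, hw⟩) = a
    rw [h, hz]
  · intro y
    constructor
    · intro h
      obtain ⟨z, rfl⟩ := Submodule.Quotient.mk_surjective _ y
      obtain ⟨c, hc⟩ := E.exists_inflate (triv G).shift z ((E.commPairing_eq_zero_iff _).1 h)
      refine ⟨Submodule.Quotient.mk c, ?_⟩
      exact ((Submodule.Quotient.eq ((triv G).shift.B1.submoduleOf _)).2 hc).symm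
    · rintro ⟨c, rfl⟩
      obtain ⟨c, rfl⟩ := Submodule.Quotient.mk_surjective _ c
      change E.commPairing (E.restrictZ1 (triv G).shift (E.inflate _ c)) = 0
      rw [restrictZ1_inflate, map_zero]

include hM hΓ in
/-- The third integral cohomology of the extension, in shifted form. -/
theorem nonempty_hOne_shift_shift_triv_equiv :
    Nonempty ((triv G).shift.shift.HOne ≃ₗ[ℤ] (triv Γ).HOne) := by
  obtain ⟨e⟩ := E.nonempty_invHOne_equiv (triv G).shift.shift
    fun z hz => E.mem_B1_shift_shift (triv G) hz
  obtain ⟨e'⟩ := E.nonempty_invHOne_shift_equiv (triv G).shift (triv Γ) hΓ E.commPairing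
    (fun q z => E.commPairing_conj M hM q z) E.commPairing_surjective E.commPairing_eq_zero_iff
  exact ⟨e.symm.trans e'⟩

include hconj in
theorem nonempty_groupCohomology_one_equiv :
    Nonempty (groupCohomology (Rep.of (triv G)) 1 ≃ₗ[ℤ] groupCohomology (Rep.of (triv Γ)) 1) := by
  obtain ⟨e⟩ := E.nonempty_hOne_triv_equiv hconj
  exact ⟨(hOneEquiv (triv G)).trans (e.trans (hOneEquiv (triv Γ)).symm)⟩

include hM hτ hΓ in
theorem nonempty_groupCohomology_two_equiv :
    Nonempty (groupCohomology (Rep.of (triv G)) 2 ≃ₗ[ℤ] groupCohomology (Rep.of τ) 1 × ℤ) := by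
  obtain ⟨e⟩ := E.nonempty_hOne_shift_triv_equiv M hM τ hτ hΓ
  let e₁ := (shiftEquiv (triv G) 0).trans (hOneEquiv (triv G).shift)
  let e₂ := e.trans ((hOneEquiv τ).symm.toAddEquiv.prodCongr (AddEquiv.refl ℤ))
  exact ⟨(e₁.toAddEquiv.trans e₂).toIntLinearEquiv⟩

include hM hΓ in
theorem nonempty_groupCohomology_three_equiv :
    Nonempty (groupCohomology (Rep.of (triv G)) 3 ≃ₗ[ℤ] groupCohomology (Rep.of (triv Γ)) 1) := by
  obtain ⟨e⟩ := E.nonempty_hOne_shift_shift_triv_equiv M hM hΓ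
  exact ⟨(shiftEquiv (triv G) 1).trans ((shiftEquiv (triv G).shift 0).trans
    ((hOneEquiv (triv G).shift.shift).trans (e.trans (hOneEquiv (triv Γ)).symm)))⟩

end Cohomology

include E in
lemma subsingleton_hOne_shift_shift_shift {k A : Type} [CommRing k] [AddCommGroup A]
    [Module k A] (hΓ : LiftsCocycles k Γ) (ρ : Representation k G A) :
    Subsingleton ρ.shift.shift.shift.HOne :=
  E.subsingleton_hOne_shift ρ.shift.shift hΓ (fun _ hz => E.mem_B1_shift_shift ρ hz)
    fun _ hz => E.mem_B1_shift_shift ρ.shift hz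

include E in
lemma subsingleton_groupCohomology_shift_shift_shift {k : Type} [CommRing k]
    (hΓ : LiftsCocycles k Γ) (n : ℕ) {A : Type} [AddCommGroup A]
    [Module k A] (ρ : Representation k G A) :
    Subsingleton (groupCohomology (Rep.of ρ.shift.shift.shift) (n + 1)) := by
  induction n generalizing A with
  | zero =>
    have := E.subsingleton_hOne_shift_shift_shift hΓ ρ
    exact (hOneEquiv ρ.shift.shift.shift).toEquiv.subsingleton
  | succ n ih =>
    have := ih ρ.shift
    exact (shiftEquiv ρ.shift.shift.shift n).toEquiv.subsingleton

include E in
lemma subsingleton_groupCohomology {k : Type} [CommRing k]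
    (hΓ : LiftsCocycles k Γ) (n : ℕ) {A : Type} [AddCommGroup A]
    [Module k A] (ρ : Representation k G A) :
    Subsingleton (groupCohomology (Rep.of ρ) (n + 4)) := by
  have := E.subsingleton_groupCohomology_shift_shift_shift hΓ n ρ
  exact ((shiftEquiv ρ (n + 2)).trans ((shiftEquiv ρ.shift (n + 1)).trans
    (shiftEquiv ρ.shift.shift n))).toEquiv.subsingleton

end SplitExt

/-! ### Lifting cocycles for groups acting freely on a free product. -/

section FreeProduct

variable {k Γ : Type} [CommRing k] [Group Γ]

/-- Inhomogeneous equivariant functions on a free product which are invariant under a free factor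
exist when the action of the product is free. -/
lemma exists_equivariant_function {F K C : Type} [Group F] [Group K] [AddCommGroup C] [Module k C]
    (φ : Γ →* F) (κ : K →* F) (hfree : ∀ γ x h, φ γ * x * κ h = x → γ = 1)
    (σ : Representation k Γ C) {c : Γ → C} (hc : c ∈ σ.Z1) :
    ∃ ψ : F → C, ∀ γ x h, ψ (φ γ * x * κ h) = σ γ (ψ x) + c γ := by
  let R : Setoid F :=
    { r x y := ∃ γ h, y = φ γ * x * κ h
      iseqv :=
        { refl x := ⟨1, 1, by simp⟩
          symm := by
            rintro x _ ⟨γ, h, rfl⟩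
            exact ⟨γ⁻¹, h⁻¹, by simp [mul_assoc]⟩
          trans := by
            rintro x _ _ ⟨γ, h, rfl⟩ ⟨γ', h', rfl⟩
            exact ⟨γ' * γ, h * h', by simp [mul_assoc]⟩ } }
  have hrep (x : F) : ∃ γ h, x = φ γ * (Quotient.mk R x).out * κ h :=
    Quotient.exact (Quotient.out_eq (Quotient.mk R x))
  choose g h hgh using hrep
  refine ⟨fun x => c (g x), fun γ x t => ?_⟩
  have hq : Quotient.mk R (φ γ * x * κ t) = Quotient.mk R x :=
    (Quotient.sound (s := R) ⟨γ, t, rfl⟩).symm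
  have hg : g (φ γ * x * κ t) = γ * g x := by
    have h1 := hgh (φ γ * x * κ t)
    rw [hq] at h1
    have h2 := hgh x
    have h3 := hfree ((g (φ γ * x * κ t))⁻¹ * (γ * g x)) (Quotient.mk R x).out
      (h x * t * (h (φ γ * x * κ t))⁻¹) (by
        have h4 : φ γ * (φ (g x) * (Quotient.mk R x).out * κ (h x)) * κ t =
          φ (g (φ γ * x * κ t)) * (Quotient.mk R x).out * κ (h (φ γ * x * κ t)) := by
          rw [← h2, ← h1]
        simp only [map_mul, map_inv]
        calc _ = (φ (g (φ γ * x * κ t)))⁻¹ *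
              (φ γ * (φ (g x) * (Quotient.mk R x).out * κ (h x)) * κ t) *
                (κ (h (φ γ * x * κ t)))⁻¹ := by group
          _ = _ := by
            rw [h4]
            group)
    exact inv_mul_eq_one.1 h3
  beta_reduce
  rw [hg, hc, add_comm]

/-- Equivariant functions lift along surjections when the action is free. -/
lemma exists_equivariant_lift {F B C : Type} [Group F] [AddCommGroup B] [Module k B]
    [AddCommGroup C] [Module k C]
    (φ : Γ →* F) (hφ : Function.Injective φ) (ρ : Representation k Γ B) (σ : Representation k Γ C)
    (f : B →ₗ[k] C) (hf : ∀ g b, f (ρ g b) = σ g (f b)) (hsurj : Function.Surjective f)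
    (δ : F → C) (hδ : ∀ γ x, δ (φ γ * x) = σ γ (δ x)) :
    ∃ d : F → B, (∀ γ x, d (φ γ * x) = ρ γ (d x)) ∧ ∀ x, f (d x) = δ x := by
  let R : Setoid F :=
    { r x y := ∃ γ, y = φ γ * x
      iseqv :=
        { refl x := ⟨1, by simp⟩
          symm := by
            rintro x _ ⟨γ, rfl⟩
            exact ⟨γ⁻¹, by simp⟩
          trans := by
            rintro x _ _ ⟨γ, rfl⟩ ⟨γ', rfl⟩
            exact ⟨γ' * γ, by simp [mul_assoc]⟩ } }
  have hrep (x : F) : ∃ γ, x = φ γ * (Quotient.mk R x).out :=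
    Quotient.exact (Quotient.out_eq (Quotient.mk R x))
  choose g hg using hrep
  choose l hl using hsurj
  refine ⟨fun x => ρ (g x) (l (δ (Quotient.mk R x).out)), fun γ x => ?_, fun x => ?_⟩
  · have hq : Quotient.mk R (φ γ * x) = Quotient.mk R x :=
      (Quotient.sound (s := R) ⟨γ, rfl⟩).symm
    have h1 := hg (φ γ * x)
    have hgx : g (φ γ * x) = γ * g x := by
      apply hφ
      rw [hq] at h1
      apply mul_right_cancel (b := (Quotient.mk R x).out)
      rw [← h1, map_mul, mul_assoc, ← hg x]
    beta_reduce
    rw [hq, hgx, map_mul, Module.End.mul_apply]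
  · beta_reduce
    rw [hf, hl, ← hδ, ← hg x]

/-- A group acting freely on a free product by left translations, and freely modulo each factor, has
liftable cocycles. -/
theorem liftsCocycles_of_coprodI {ι : Type} [Nonempty ι] {H : ι → Type} [∀ i, Group (H i)]
    (φ : Γ →* Monoid.CoprodI H)
    (hfree : ∀ i γ x (h : H i), φ γ * x * Monoid.CoprodI.of h = x → γ = 1) :
    LiftsCocycles k Γ := by
  intro B C _ _ _ _ ρ σ f hf hsurj c hc
  let i₀ : ι := Classical.arbitrary ι
  have hφ : Function.Injective φ := by
    rw [injective_iff_map_eq_one]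
    intro γ hγ
    exact hfree i₀ γ 1 1 (by simp [hγ])
  -- The function `ψ i` trivialises `c` on the vertices `F / H i` of the tree, where `F` is the free
  -- product. The differences `ψ i - ψ i₀` are equivariant without a twist, so they lift along `f`.
  choose ψ hψ using fun i => exists_equivariant_function φ
    (Monoid.CoprodI.of : H i →* Monoid.CoprodI H) (hfree i) σ hc
  have hψ1 (i γ x) : ψ i (φ γ * x) = σ γ (ψ i x) + c γ := by simpa using hψ i γ x 1
  have hψ2 (i x) (h : H i) : ψ i (x * Monoid.CoprodI.of h) = ψ i x := by
    simpa [Z1_map_one hc] using hψ i 1 x h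
  choose d hd hdf using fun i => exists_equivariant_lift φ hφ ρ σ f hf hsurj
    (fun x => ψ i x - ψ i₀ x) fun γ x => by
      rw [hψ1, hψ1, map_sub]
      abel
  -- An affine action of the free product on functions, prescribed on each factor by a coboundary.
  -- Its translation part `β` is a cocycle on the whole product lifting the coboundary of `ψ i₀`,
  -- because `ψ i` is constant along `H i`.
  let T : Monoid.CoprodI H →* Function.End (Monoid.CoprodI H → B) := Monoid.CoprodI.lift fun i =>
    { toFun h m x := m (x * Monoid.CoprodI.of h) + (d i x - d i (x * Monoid.CoprodI.of h))
      map_one' := by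
        funext m x
        change m (x * Monoid.CoprodI.of 1) + (d i x - d i (x * Monoid.CoprodI.of 1)) = m x
        simp
      map_mul' h h' := by
        funext m x
        change _ = m (x * Monoid.CoprodI.of h * Monoid.CoprodI.of h') +
          (d i (x * Monoid.CoprodI.of h) - d i (x * Monoid.CoprodI.of h * Monoid.CoprodI.of h')) +
          (d i x - d i (x * Monoid.CoprodI.of h))
        rw [map_mul, mul_assoc]
        abel }
  have key (g : Monoid.CoprodI H) : ∃ β : Monoid.CoprodI H → B,
      (∀ m x, T g m x = m (x * g) + β x) ∧ (∀ γ x, β (φ γ * x) = ρ γ (β x)) ∧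
        ∀ x, f (β x) = ψ i₀ (x * g) - ψ i₀ x := by
    induction g using Monoid.CoprodI.induction_on with
    | one =>
      refine ⟨0, fun m x => ?_, by simp, by simp⟩
      rw [map_one]
      change m x = _
      simp
    | of i h =>
      refine ⟨fun x => d i x - d i (x * Monoid.CoprodI.of h), fun m x => ?_, fun γ x => ?_,
        fun x => ?_⟩
      · simp only [T, Monoid.CoprodI.lift_of]
        rfl
      · beta_reduce
        rw [mul_assoc, hd, hd, map_sub]
      · beta_reduce
        rw [map_sub, hdf, hdf, hψ2]
        abel
    | mul g h hg hh =>
      obtain ⟨β, h1, h2, h3⟩ := hg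
      obtain ⟨β', h1', h2', h3'⟩ := hh
      refine ⟨fun x => β' (x * g) + β x, fun m x => ?_, fun γ x => ?_, fun x => ?_⟩
      · rw [map_mul]
        change T g (T h m) x = _
        rw [h1, h1', mul_assoc, add_assoc]
      · beta_reduce
        rw [mul_assoc, h2, h2', map_add]
      · beta_reduce
        rw [map_add, h3, h3', mul_assoc]
        abel
  choose β hT hβ hfβ using key
  have hβmul (g h x) : β (g * h) x = β h (x * g) + β g x := by
    have h1 := hT (g * h) 0 x
    rw [map_mul] at h1
    change T g (T h 0) x = _ at h1
    rw [hT, hT] at h1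
    simpa using h1.symm
  obtain ⟨b₀, hb₀⟩ := hsurj (ψ i₀ 1)
  -- Along `Γ`, `f (β · 1)` is `c` plus the coboundary of `ψ i₀ 1`; the subtracted term lifts that
  -- coboundary.
  refine ⟨fun γ => β (φ γ) 1 - (ρ γ b₀ - b₀), fun γ γ' => ?_, fun γ => ?_⟩
  · have h1 := hβ (φ γ') γ 1
    rw [mul_one] at h1
    beta_reduce
    rw [map_mul, hβmul, one_mul, h1, map_mul, Module.End.mul_apply, map_sub, map_sub]
    abel
  · have h1 := hψ1 i₀ γ 1
    rw [mul_one] at h1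
    beta_reduce
    rw [map_sub, hfβ, map_sub, hf, hb₀, one_mul, h1]
    abel

end FreeProduct

/-! ### The projective modular group as a free product, and its congruence subgroups. -/

section

open UpperHalfPlane

namespace ModularGroup

/-- The element of order three in the modular group. -/
def torsionThree : SL(2, ℤ) := T * S

lemma coe_torsionThree : torsionThree.1 = !![1, -1; 1, 0] := by
  simp [torsionThree, coe_T, coe_S]

/-- The action of the modular group on the upper half plane. -/
def permHom : SL(2, ℤ) →* Equiv.Perm ℍ := MulAction.toPermHom SL(2, ℤ) ℍ

lemma permHom_apply (g : SL(2, ℤ)) (z : ℍ) : permHom g z = g • z := rfl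

lemma eq_one_or_neg_one_of_permHom {g : SL(2, ℤ)} (hg : permHom g = 1) : g = 1 ∨ g = -1 := by
  have key (z : ℍ) : ((g 0 0 : ℝ) * z + (g 0 1 : ℝ) : ℂ) = z * ((g 1 0 : ℝ) * z + (g 1 1 : ℝ)) := by
    have h1 : g • z = z := DFunLike.congr_fun hg z
    have h2 : (((g • z : ℍ)) : ℂ) = z := by rw [h1]
    have h3 : ((g 1 0 : ℝ) * z + (g 1 1 : ℝ) : ℂ) ≠ 0 := UpperHalfPlane.denom_ne_zero g z
    rw [UpperHalfPlane.coe_specialLinearGroup_apply, div_eq_iff (by exact_mod_cast h3)] at h2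
    exact_mod_cast h2
  -- Fixing `i` and `2i` already forces a scalar matrix.
  have h1 := key UpperHalfPlane.I
  have h2 := key ⟨2 * Complex.I, by simp⟩
  have h1r := congrArg Complex.re h1
  have h1i := congrArg Complex.im h1
  have h2r := congrArg Complex.re h2
  simp at h1r h1i h2r
  have hb : g 0 1 = -g 1 0 := by exact_mod_cast h1r
  have hd : g 0 0 = g 1 1 := by exact_mod_cast h1i
  have hb' : g 0 1 = -(2 * (g 1 0 * 2)) := by
    have h3 : ((g 0 1 : ℤ) : ℝ) = ((-(2 * (g 1 0 * 2)) : ℤ) : ℝ) := by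
      push_cast
      exact h2r
    exact_mod_cast h3
  have h10 : g 1 0 = 0 := by lia
  have h01 : g 0 1 = 0 := by lia
  have hdet := g.2
  rw [Matrix.det_fin_two] at hdet
  change g 0 0 * g 1 1 - g 0 1 * g 1 0 = 1 at hdet
  rw [h10, hd] at hdet
  have h11 : g 1 1 = 1 ∨ g 1 1 = -1 := mul_self_eq_one_iff.1 (by linarith)
  rcases h11 with h | h
  · left
    ext i l
    fin_cases i <;> fin_cases l <;> simp [h10, h01, hd, h]
  · right
    ext i l
    fin_cases i <;> fin_cases l <;> simp [h10, h01, hd, h]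

lemma permHom_neg (g : SL(2, ℤ)) : permHom (-g) = permHom g :=
  Equiv.ext fun z => ModularGroup.SL_neg_smul g z

lemma S_sq : S * S = -1 := by
  ext i l
  fin_cases i <;> fin_cases l <;> simp [coe_S, Matrix.mul_apply, Fin.sum_univ_two]

lemma torsionThree_cube : torsionThree * torsionThree * torsionThree = -1 := by
  ext i l
  fin_cases i <;> fin_cases l <;>
    simp [coe_torsionThree, Matrix.mul_apply, Fin.sum_univ_two]

/-- The generators of finite order of the projective modular group, as permutations. -/
def torsionPerm : Fin 2 → Equiv.Perm ℍ := ![permHom S, permHom torsionThree]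

lemma torsionPerm_zero_sq : torsionPerm 0 ^ 2 = 1 := by
  change permHom S ^ 2 = 1
  rw [pow_two, ← map_mul, S_sq, permHom_neg, map_one]

lemma torsionPerm_one_cube : torsionPerm 1 ^ 3 = 1 := by
  change permHom torsionThree ^ 3 = 1
  rw [pow_succ, pow_two, ← map_mul, ← map_mul, torsionThree_cube, permHom_neg, map_one]

lemma permHom_ne_one {g : SL(2, ℤ)} (hg : g 1 0 = 1) : permHom g ≠ 1 := by
  intro h
  rcases eq_one_or_neg_one_of_permHom h with rfl | rfl <;> simp at hg

lemma orderOf_torsionPerm_zero : orderOf (torsionPerm 0) = 2 :=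
  haveI : Fact (Nat.Prime 2) := ⟨Nat.prime_two⟩
  orderOf_eq_prime torsionPerm_zero_sq (permHom_ne_one (by simp [coe_S]))

lemma orderOf_torsionPerm_one : orderOf (torsionPerm 1) = 3 :=
  haveI : Fact (Nat.Prime 3) := ⟨Nat.prime_three⟩
  orderOf_eq_prime torsionPerm_one_cube (permHom_ne_one (by simp [coe_torsionThree]))

lemma mem_zpowers_torsionPerm_zero {a : Equiv.Perm ℍ}
    (ha : a ∈ Subgroup.zpowers (torsionPerm 0)) : a = 1 ∨ a = permHom S := by
  classical
  have hfin : IsOfFinOrder (torsionPerm 0) :=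
    orderOf_pos_iff.1 (by rw [orderOf_torsionPerm_zero]; norm_num)
  rw [hfin.mem_zpowers_iff_mem_range_orderOf, orderOf_torsionPerm_zero, Finset.mem_image] at ha
  obtain ⟨n, hn, rfl⟩ := ha
  rw [Finset.mem_range] at hn
  interval_cases n
  · exact Or.inl (pow_zero _)
  · exact Or.inr (pow_one _)

lemma mem_zpowers_torsionPerm_one {a : Equiv.Perm ℍ}
    (ha : a ∈ Subgroup.zpowers (torsionPerm 1)) :
    a = 1 ∨ a = permHom torsionThree ∨ a = permHom (torsionThree * torsionThree) := by
  classical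
  have hfin : IsOfFinOrder (torsionPerm 1) :=
    orderOf_pos_iff.1 (by rw [orderOf_torsionPerm_one]; norm_num)
  rw [hfin.mem_zpowers_iff_mem_range_orderOf, orderOf_torsionPerm_one, Finset.mem_image] at ha
  obtain ⟨n, hn, rfl⟩ := ha
  rw [Finset.mem_range] at hn
  interval_cases n
  · exact Or.inl (pow_zero _)
  · exact Or.inr (Or.inl (pow_one _))
  · refine Or.inr (Or.inr ?_)
    rw [pow_two, map_mul]
    rfl

lemma exists_of_mem_zpowers {i : Fin 2} {a : Equiv.Perm ℍ}
    (ha : a ∈ Subgroup.zpowers (torsionPerm i)) :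
    a = 1 ∨ ∃ g : SL(2, ℤ), g 1 0 = 1 ∧ a = permHom g := by
  fin_cases i
  · rcases mem_zpowers_torsionPerm_zero ha with h | h
    · exact Or.inl h
    · exact Or.inr ⟨S, by simp [coe_S], h⟩
  · rcases mem_zpowers_torsionPerm_one ha with h | h | h
    · exact Or.inl h
    · exact Or.inr ⟨_, by simp [coe_torsionThree], h⟩
    · exact Or.inr ⟨_, by simp [coe_torsionThree], h⟩

lemma S_smul_re (z : ℍ) : (S • z).re = -(z.re / Complex.normSq z) := by
  rw [UpperHalfPlane.modular_S_smul]
  change ((-(z : ℂ))⁻¹).re = _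
  rw [Complex.inv_re, Complex.normSq_neg, Complex.neg_re, neg_div]
  rfl

lemma torsionThree_smul_re (z : ℍ) : (torsionThree • z).re = 1 - z.re / Complex.normSq z := by
  rw [torsionThree, mul_smul, UpperHalfPlane.modular_T_smul, UpperHalfPlane.vadd_re, S_smul_re]
  ring

lemma S_smul_re_neg {z : ℍ} (hz : 0 < z.re) : (S • z).re < 0 := by
  rw [S_smul_re, neg_lt_zero]
  exact div_pos hz (UpperHalfPlane.normSq_pos z)

lemma one_lt_torsionThree_smul_re {z : ℍ} (hz : z.re < 0) : 1 < (torsionThree • z).re := by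
  rw [torsionThree_smul_re]
  have := div_neg_of_neg_of_pos hz (UpperHalfPlane.normSq_pos z)
  linarith

lemma torsionThree_smul_re_pos {z : ℍ} (hz : 1 < z.re) : 0 < (torsionThree • z).re := by
  rw [torsionThree_smul_re, sub_pos, div_lt_one (UpperHalfPlane.normSq_pos z),
    Complex.normSq_apply]
  change z.re < z.re * z.re + z.im * z.im
  nlinarith [mul_self_nonneg z.im]

/-- The free factors of the projective modular group. -/
abbrev Factor (i : Fin 2) : Type := Subgroup.zpowers (torsionPerm i)

/-- The natural map from the free product of the finite factors. -/
def fromCoprod : Monoid.CoprodI Factor →* Equiv.Perm ℍ :=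
  Monoid.CoprodI.lift fun i => (Subgroup.zpowers (torsionPerm i)).subtype

lemma fromCoprod_of (i : Fin 2) (h : Factor i) : fromCoprod (Monoid.CoprodI.of h) = h.1 := by
  simp [fromCoprod]

open scoped Pointwise in
/-- The projective modular group is the free product of cyclic groups of orders two and three. -/
theorem fromCoprod_injective : Function.Injective fromCoprod := by
  -- Ping-pong between the left and right halves of `ℍ`. The criterion needs a factor with at least
  -- three elements, here the one of order three.
  refine Monoid.CoprodI.lift_injective_of_ping_pong (α := ℍ) _ (Or.inr ⟨1, ?_⟩)
    ![{z : ℍ | z.re < 0}, {z : ℍ | 0 < z.re}] ?_ ?_ ?_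
  · have h : Nat.card (Factor 1) = 3 := by rw [Nat.card_zpowers, orderOf_torsionPerm_one]
    have hfin : Finite (Factor 1) := Nat.finite_of_card_ne_zero (by rw [h]; norm_num)
    rw [← Nat.cast_card, h]
    norm_num
  · intro i
    fin_cases i
    · exact ⟨⟨-1 + Complex.I, by simp⟩, by change (-1 + Complex.I : ℂ).re < 0; simp⟩
    · exact ⟨⟨1 + Complex.I, by simp⟩, by change 0 < (1 + Complex.I : ℂ).re; simp⟩
  · intro i l hil
    fin_cases i <;> fin_cases l
    · exact absurd rfl hil
    · exact Set.disjoint_left.2 fun z (h : z.re < 0) (h' : 0 < z.re) => lt_asymm h h'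
    · exact Set.disjoint_left.2 fun z (h : 0 < z.re) (h' : z.re < 0) => lt_asymm h h'
    · exact absurd rfl hil
  · intro i l hil h hh
    have hne : h.1 ≠ 1 := fun h1 => hh (Subtype.ext h1)
    fin_cases i <;> fin_cases l
    · exact absurd rfl hil
    · rcases mem_zpowers_torsionPerm_zero h.2 with h1 | h1
      · exact absurd h1 hne
      · rintro _ ⟨z, hz, rfl⟩
        change (h.1 z).re < 0
        rw [h1]
        exact S_smul_re_neg hz
    · rcases mem_zpowers_torsionPerm_one h.2 with h1 | h1 | h1
      · exact absurd h1 hne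
      · rintro _ ⟨z, hz, rfl⟩
        change 0 < (h.1 z).re
        rw [h1]
        exact one_pos.trans (one_lt_torsionThree_smul_re hz)
      · rintro _ ⟨z, hz, rfl⟩
        change 0 < (h.1 z).re
        rw [h1, permHom_apply, mul_smul]
        exact torsionThree_smul_re_pos (one_lt_torsionThree_smul_re hz)
    · exact absurd rfl hil

lemma range_fromCoprod : fromCoprod.range = permHom.range := by
  apply le_antisymm
  · rintro _ ⟨x, rfl⟩
    induction x using Monoid.CoprodI.induction_on with
    | one => exact one_mem _
    | of i h =>
      rw [fromCoprod_of]
      rcases exists_of_mem_zpowers h.2 with h1 | ⟨g, -, h1⟩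
      · rw [h1]
        exact one_mem _
      · exact ⟨g, h1.symm⟩
    | mul x y hx hy =>
      rw [map_mul]
      exact mul_mem hx hy
  · have hS : permHom S ∈ fromCoprod.range :=
      ⟨Monoid.CoprodI.of (i := 0) ⟨_, Subgroup.mem_zpowers _⟩, fromCoprod_of _ _⟩
    have hR : permHom torsionThree ∈ fromCoprod.range :=
      ⟨Monoid.CoprodI.of (i := 1) ⟨_, Subgroup.mem_zpowers _⟩, fromCoprod_of _ _⟩
    rw [MonoidHom.range_eq_map, ← SpecialLinearGroup.SL2Z_generators, MonoidHom.map_closure,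
      Subgroup.closure_le]
    rintro _ ⟨g, rfl | rfl, rfl⟩
    · exact hS
    · have hT : T = torsionThree * S⁻¹ := by rw [torsionThree, mul_inv_cancel_right]
      rw [hT, map_mul, map_inv]
      exact mul_mem hR (inv_mem hS)

/-- Nontrivial elements of the finite factors are represented by matrices with lower left entry one.
The entry condition together with normality therefore keeps `Γ` away from all their conjugates, and
excluding `-1` makes `Γ` embed in the projective group. -/
lemma liftsCocycles_of_subgroup (k : Type) [CommRing k] (Γ : Subgroup SL(2, ℤ)) [Γ.Normal]
    (hneg : -1 ∉ Γ) (hΓ : ∀ g ∈ Γ, g 1 0 ≠ 1 ∧ g 1 0 ≠ -1) : LiftsCocycles k Γ := by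
  have hex (γ : Γ) : ∃ x, fromCoprod x = permHom γ.1 := by
    have : permHom γ.1 ∈ fromCoprod.range := by
      rw [range_fromCoprod]
      exact ⟨_, rfl⟩
    exact this
  choose φ₀ hφ₀ using hex
  let φ : Γ →* Monoid.CoprodI Factor := MonoidHom.mk' φ₀ fun a b => fromCoprod_injective (by
    rw [map_mul, hφ₀, hφ₀, hφ₀]
    exact map_mul permHom a.1 b.1)
  have hφ (γ : Γ) : fromCoprod (φ γ) = permHom γ.1 := hφ₀ γ
  refine liftsCocycles_of_coprodI φ fun i γ x h hx => ?_
  obtain ⟨g, hg⟩ : fromCoprod x ∈ permHom.range := by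
    rw [← range_fromCoprod]
    exact ⟨x, rfl⟩
  have h1 := congrArg fromCoprod hx
  rw [map_mul, map_mul, fromCoprod_of, hφ, ← hg] at h1
  obtain ⟨m, hm, hmh⟩ : ∃ m : SL(2, ℤ), (m = 1 ∨ m 1 0 = 1) ∧ h.1 = permHom m := by
    rcases exists_of_mem_zpowers h.2 with h2 | ⟨m, hm, h2⟩
    · exact ⟨1, Or.inl rfl, by rw [h2, map_one]⟩
    · exact ⟨m, Or.inr hm, h2⟩
  have hmem : g⁻¹ * γ.1⁻¹ * g ∈ Γ := by
    simpa using Subgroup.Normal.conj_mem ‹Γ.Normal› _ (inv_mem γ.2) g⁻¹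
  have hker : permHom (g⁻¹ * γ.1 * g * m) = 1 := by
    rw [map_mul, map_mul, map_mul, map_inv, mul_assoc, mul_assoc, inv_mul_eq_one, ← mul_assoc,
      ← hmh]
    exact h1.symm
  have hm' : m = g⁻¹ * γ.1⁻¹ * g ∨ -m = g⁻¹ * γ.1⁻¹ * g := by
    rcases eq_one_or_neg_one_of_permHom hker with h2 | h2
    · left
      rw [eq_inv_of_mul_eq_one_right h2]
      group
    · right
      have h3 : g⁻¹ * γ.1 * g * -m = 1 := by rw [mul_neg, h2, neg_neg]
      rw [eq_inv_of_mul_eq_one_right h3]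
      group
  have hone : m = 1 := by
    rcases hm with hm | hm
    · exact hm
    · exfalso
      rcases hm' with h2 | h2
      · exact (hΓ _ hmem).1 (h2 ▸ hm)
      · refine (hΓ _ hmem).2 ?_
        rw [← h2]
        simpa using hm
  subst hone
  rcases hm' with h2 | h2
  · refine Subtype.ext (inv_eq_one.1 ?_)
    have h3 : γ.1⁻¹ = g * (g⁻¹ * γ.1⁻¹ * g) * g⁻¹ := by group
    rw [h3, ← h2]
    simp
  · exact absurd (h2 ▸ hmem) hneg

end ModularGroup

/-- Principal congruence subgroups of odd level at least three have liftable cocycles. -/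
theorem CongruenceSubgroup.liftsCocycles_Gamma (k : Type) [CommRing k] (p : ℕ) (hp : 2 < p) :
    LiftsCocycles k (CongruenceSubgroup.Gamma p) := by
  have : Fact (2 < p) := ⟨hp⟩
  have : Fact (1 < p) := ⟨by lia⟩
  have := CongruenceSubgroup.Gamma_normal p
  refine ModularGroup.liftsCocycles_of_subgroup k _ ?_ ?_
  · intro h
    have h1 := (CongruenceSubgroup.Gamma_mem.1 h).1
    simp at h1
    exact ZMod.neg_one_ne_one h1
  · intro g hg
    have h1 := (CongruenceSubgroup.Gamma_mem.1 hg).2.2.1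
    constructor <;> intro h2 <;> rw [h2] at h1 <;> simp at h1

end

/-! ### The group $P_2\cap\Gamma(p)$ as an affine group. -/

namespace ParabolicCongruence

variable (p : ℕ)

/-- The affine matrix with given linear part and translation part. -/
def affineMatrix (A : Matrix (Fin 2) (Fin 2) ℤ) (w : Fin 2 → ℤ) : Matrix (Fin 3) (Fin 3) ℤ :=
  !![A 0 0, A 0 1, w 0; A 1 0, A 1 1, w 1; 0, 0, 1]

lemma affineMatrix_mul (A B : Matrix (Fin 2) (Fin 2) ℤ) (w u : Fin 2 → ℤ) :
    affineMatrix A w * affineMatrix B u = affineMatrix (A * B) (A.mulVec u + w) := by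
  ext i l
  fin_cases i <;> fin_cases l <;>
    simp [affineMatrix, Matrix.mul_apply, Fin.sum_univ_three, Fin.sum_univ_two]

lemma det_affineMatrix (A : Matrix (Fin 2) (Fin 2) ℤ) (w : Fin 2 → ℤ) :
    (affineMatrix A w).det = A.det := by
  simp [affineMatrix, Matrix.det_fin_three, Matrix.det_fin_two]

lemma mem_Gamma3 {g : SL(3, ℤ)} :
    g ∈ Gamma3 p ↔ ∀ i l, ((g.1 i l : ℤ) : ZMod p) = (1 : Matrix (Fin 3) (Fin 3) (ZMod p)) i l := by
  rw [Gamma3, MonoidHom.mem_ker, Matrix.SpecialLinearGroup.ext_iff]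
  rfl

/-- The affine element with linear part in the congruence subgroup and translation part divisible
by `p`. -/
def mk (q : CongruenceSubgroup.Gamma p) (u : Fin 2 → ℤ) : ↥(parabolicP2 ⊓ Gamma3 p) :=
  ⟨⟨affineMatrix q.1.1 ((p : ℤ) • u), (det_affineMatrix _ _).trans q.1.2⟩, by
    refine ⟨⟨rfl, rfl⟩, (mem_Gamma3 p).2 fun i l => ?_⟩
    obtain ⟨h1, h2, h3, h4⟩ := CongruenceSubgroup.Gamma_mem.1 q.2
    fin_cases i <;> fin_cases l <;> simp [affineMatrix, h1, h2, h3, h4]⟩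

lemma mk_coe (q : CongruenceSubgroup.Gamma p) (u : Fin 2 → ℤ) :
    (mk p q u).1.1 = affineMatrix q.1.1 ((p : ℤ) • u) := rfl

lemma mk_mul (q r : CongruenceSubgroup.Gamma p) (u v : Fin 2 → ℤ) :
    mk p q u * mk p r v = mk p (q * r) (q.1.1.mulVec v + u) := by
  refine Subtype.ext (Subtype.ext ?_)
  change affineMatrix _ _ * affineMatrix _ _ = affineMatrix (q.1.1 * r.1.1) _
  rw [affineMatrix_mul, Matrix.mulVec_smul, smul_add]

lemma mk_injective (hp : p ≠ 0) {q r : CongruenceSubgroup.Gamma p} {u v : Fin 2 → ℤ}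
    (h : mk p q u = mk p r v) : q = r ∧ u = v := by
  have key (i l) : affineMatrix q.1.1 ((p : ℤ) • u) i l = affineMatrix r.1.1 ((p : ℤ) • v) i l := by
    rw [← mk_coe, ← mk_coe, h]
  have hp' : (p : ℤ) ≠ 0 := by exact_mod_cast hp
  constructor
  · refine Subtype.ext (Subtype.ext (Matrix.ext fun i l => ?_))
    fin_cases i <;> fin_cases l
    · exact key 0 0
    · exact key 0 1
    · exact key 1 0
    · exact key 1 1
  · funext i
    fin_cases i
    · exact mul_left_cancel₀ hp' (key 0 2)
    · exact mul_left_cancel₀ hp' (key 1 2)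

lemma mk_surjective (hp : 2 < p) (g : ↥(parabolicP2 ⊓ Gamma3 p)) : ∃ q u, mk p q u = g := by
  obtain ⟨g, ⟨h0, h1⟩, hg⟩ := g
  replace hg := (mem_Gamma3 p).1 hg
  have hdet := g.2
  rw [Matrix.det_fin_three, h0, h1] at hdet
  have hprod : (g.1 0 0 * g.1 1 1 - g.1 0 1 * g.1 1 0) * g.1 2 2 = 1 := by linear_combination hdet
  -- The determinant makes this entry a unit; `-1` is excluded modulo `p` because `p > 2`.
  have h22 : g.1 2 2 = 1 := by
    rcases Int.eq_one_or_neg_one_of_mul_eq_one' hprod with h | h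
    · exact h.2
    · exfalso
      have hneg := hg 2 2
      rw [h.2] at hneg
      have : Fact (2 < p) := ⟨hp⟩
      exact ZMod.neg_one_ne_one (n := p) (by simpa using hneg)
  rw [h22, mul_one] at hprod
  have hdvd (i : Fin 3) (hi : i ≠ 2) : (p : ℤ) ∣ g.1 i 2 := by
    rw [← ZMod.intCast_zmod_eq_zero_iff_dvd, hg, Matrix.one_apply_ne hi]
  obtain ⟨a, ha⟩ := hdvd 0 (by decide)
  obtain ⟨b, hb⟩ := hdvd 1 (by decide)
  let q : SL(2, ℤ) := ⟨!![g.1 0 0, g.1 0 1; g.1 1 0, g.1 1 1], by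
    rw [Matrix.det_fin_two_of, hprod]⟩
  have hq : q ∈ CongruenceSubgroup.Gamma p := by
    rw [CongruenceSubgroup.Gamma_mem]
    exact ⟨by simpa [q] using hg 0 0, by simpa [q] using hg 0 1, by simpa [q] using hg 1 0,
      by simpa [q] using hg 1 1⟩
  refine ⟨⟨q, hq⟩, ![a, b], Subtype.ext (Subtype.ext ?_)⟩
  rw [mk_coe]
  ext i l
  fin_cases i <;> fin_cases l <;> simp [affineMatrix, q, h0, h1, h22, ha, hb]

/-- The action of the congruence subgroup on the lattice. -/
def latticeAction : CongruenceSubgroup.Gamma p →* MulAut (Multiplicative (Fin 2 → ℤ)) where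
  toFun q :=
    { toFun n := Multiplicative.ofAdd (q.1.1.mulVec n.toAdd)
      invFun n := Multiplicative.ofAdd ((q⁻¹).1.1.mulVec n.toAdd)
      left_inv n := by
        have h : (q⁻¹).1.1 * q.1.1 = 1 := congrArg (fun x => x.1.1) (inv_mul_cancel q)
        simp only [toAdd_ofAdd, Matrix.mulVec_mulVec, h, Matrix.one_mulVec, ofAdd_toAdd]
      right_inv n := by
        have h : q.1.1 * (q⁻¹).1.1 = 1 := congrArg (fun x => x.1.1) (mul_inv_cancel q)
        simp only [toAdd_ofAdd, Matrix.mulVec_mulVec, h, Matrix.one_mulVec, ofAdd_toAdd]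
      map_mul' m n := by rw [toAdd_mul, Matrix.mulVec_add, ofAdd_add] }
  map_one' := by
    ext n
    simp
  map_mul' q r := by
    refine MulEquiv.ext fun n => ?_
    change Multiplicative.ofAdd ((q.1.1 * r.1.1).mulVec n.toAdd) =
      Multiplicative.ofAdd (q.1.1.mulVec (r.1.1.mulVec n.toAdd))
    rw [Matrix.mulVec_mulVec]

lemma latticeAction_toAdd (q : CongruenceSubgroup.Gamma p) (n : Multiplicative (Fin 2 → ℤ)) :
    (latticeAction p q n).toAdd = q.1.1.mulVec n.toAdd := rfl

/-- The two elementary matrices with off-diagonal entry `p` force `p` times each coordinate of `φ`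
to vanish. -/
lemma eq_zero_of_latticeAction_invariant (hp : p ≠ 0) (φ : Multiplicative (Fin 2 → ℤ) → ℤ)
    (hmul : ∀ m n, φ (m * n) = φ m + φ n) (hinv : ∀ q n, φ (latticeAction p q n) = φ n) :
    φ = 0 := by
  let a : SL(2, ℤ) := ⟨!![1, p; 0, 1], by simp⟩
  let b : SL(2, ℤ) := ⟨!![1, 0; p, 1], by simp⟩
  have ha : a ∈ CongruenceSubgroup.Gamma p := by
    rw [CongruenceSubgroup.Gamma_mem]
    simp [a]
  have hb : b ∈ CongruenceSubgroup.Gamma p := by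
    rw [CongruenceSubgroup.Gamma_mem]
    simp [b]
  have h0 := hinv ⟨a, ha⟩ (stdGen 1)
  have h1 := hinv ⟨b, hb⟩ (stdGen 0)
  rw [map_eq_of_map_mul_eq_add φ hmul, latticeAction_toAdd] at h0 h1
  simp [stdGen, a, b, hp] at h0 h1
  funext n
  rw [map_eq_of_map_mul_eq_add φ hmul]
  simp [stdGen, h0, h1]

/-- The group `P₂ ∩ Γ(p)` as a semidirect product. -/
def splitExt (hp : 2 < p) :
    SplitExt ↥(parabolicP2 ⊓ Gamma3 p) (CongruenceSubgroup.Gamma p)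
      (Multiplicative (Fin 2 → ℤ)) :=
  let lin (g : ↥(parabolicP2 ⊓ Gamma3 p)) : CongruenceSubgroup.Gamma p :=
    (mk_surjective p hp g).choose
  let tr (g : ↥(parabolicP2 ⊓ Gamma3 p)) : Fin 2 → ℤ := (mk_surjective p hp g).choose_spec.choose
  have hmk (g) : mk p (lin g) (tr g) = g := (mk_surjective p hp g).choose_spec.choose_spec
  have hinj {q r : CongruenceSubgroup.Gamma p} {u v : Fin 2 → ℤ} (h : mk p q u = mk p r v) :
    q = r ∧ u = v := mk_injective p (by lia) h
  have hlin (q u) : lin (mk p q u) = q := (hinj (hmk (mk p q u))).1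
  have htr (q u) : tr (mk p q u) = u := (hinj (hmk (mk p q u))).2
  have hinv (q : CongruenceSubgroup.Gamma p) (v : Fin 2 → ℤ) :
      q.1.1.mulVec ((q⁻¹).1.1.mulVec v) = v := by
    have h : q.1.1 * (q⁻¹).1.1 = 1 := congrArg (fun x => x.1.1) (mul_inv_cancel q)
    rw [Matrix.mulVec_mulVec, h, Matrix.one_mulVec]
  have hinv' (q : CongruenceSubgroup.Gamma p) (v : Fin 2 → ℤ) :
      (q⁻¹).1.1.mulVec (q.1.1.mulVec v) = v := by
    have h : (q⁻¹).1.1 * q.1.1 = 1 := congrArg (fun x => x.1.1) (inv_mul_cancel q)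
    rw [Matrix.mulVec_mulVec, h, Matrix.one_mulVec]
  have hone (v : Fin 2 → ℤ) : (1 : CongruenceSubgroup.Gamma p).1.1.mulVec v = v :=
    Matrix.one_mulVec v
  { s := MonoidHom.mk' (fun q => mk p q 0) fun q r => by
      rw [mk_mul, Matrix.mulVec_zero, add_zero]
    π := MonoidHom.mk' lin fun g h => by
      conv_lhs => rw [← hmk g, ← hmk h, mk_mul, hlin]
    j := MonoidHom.mk' (fun n => mk p 1 n.toAdd) fun m n => by
      rw [mk_mul, hone, one_mul, toAdd_mul, add_comm]
    -- The kernel factor stands on the right in `s q * j n`, so the translation part must be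
    -- untwisted by the linear part.
    p := fun g => Multiplicative.ofAdd (((lin g)⁻¹).1.1.mulVec (tr g))
    conj := latticeAction p
    π_s := fun q => hlin q 0
    π_j := fun n => hlin 1 _
    p_s := fun q => by
      change Multiplicative.ofAdd (((lin (mk p q 0))⁻¹).1.1.mulVec (tr (mk p q 0))) = 1
      rw [htr, Matrix.mulVec_zero]
      rfl
    p_mul_j := fun g n => by
      change Multiplicative.ofAdd (((lin (g * mk p 1 n.toAdd))⁻¹).1.1.mulVec
        (tr (g * mk p 1 n.toAdd))) = Multiplicative.ofAdd (((lin g)⁻¹).1.1.mulVec (tr g)) * n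
      have h : g * mk p 1 n.toAdd = mk p (lin g) ((lin g).1.1.mulVec n.toAdd + tr g) := by
        conv_lhs => rw [← hmk g, mk_mul, mul_one]
      rw [h, hlin, htr, Matrix.mulVec_add, hinv', ofAdd_add, mul_comm]
      rfl
    s_mul_j_p := fun g => by
      change mk p (lin g) 0 * mk p 1 (((lin g)⁻¹).1.1.mulVec (tr g)) = g
      rw [mk_mul, hinv, mul_one, add_zero, hmk]
    s_mul_j := fun q n => by
      change mk p q 0 * mk p 1 n.toAdd = mk p 1 (q.1.1.mulVec n.toAdd) * mk p q 0
      rw [mk_mul, mk_mul, hone, mul_one, one_mul, add_zero, zero_add] }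

end ParabolicCongruence

end

open ParabolicCongruence SplitExt Representation

theorem proposition2p3 (p : ℕ) (hp : p.Prime) (hodd : Odd p) :
    Nonempty (integralCohomology ↥(parabolicP2 ⊓ Gamma3 p) 0 ≃ₗ[ℤ] ℤ) ∧
    Nonempty (integralCohomology ↥(parabolicP2 ⊓ Gamma3 p) 1 ≃ₗ[ℤ]
      integralCohomology (CongruenceSubgroup.Gamma p) 1) ∧
    Nonempty (integralCohomology ↥(parabolicP2 ⊓ Gamma3 p) 2 ≃ₗ[ℤ]
      (groupCohomology (dualRep p) 1 × ℤ)) ∧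
    Nonempty (integralCohomology ↥(parabolicP2 ⊓ Gamma3 p) 3 ≃ₗ[ℤ]
      integralCohomology (CongruenceSubgroup.Gamma p) 1) ∧
    ∀ i : ℕ, 4 ≤ i → Subsingleton (integralCohomology ↥(parabolicP2 ⊓ Gamma3 p) i) := by
  have h2 : 2 < p := by
    have := hp.two_le
    obtain ⟨m, rfl⟩ := hodd
    lia
  let E := splitExt p h2
  have hΓ := CongruenceSubgroup.liftsCocycles_Gamma ℤ p h2
  let M : CongruenceSubgroup.Gamma p →* SL(2, ℤ) := (CongruenceSubgroup.Gamma p).subtype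
  have hM (q n) : (E.conj q n).toAdd = (M q).1.mulVec n.toAdd := rfl
  have hτ (q f v) : (naturalRep p).dual q f v = f ((M q⁻¹).1.mulVec v) := rfl
  let G := ↥(parabolicP2 ⊓ Gamma3 p)
  exact ⟨⟨(groupCohomology.H0IsoOfIsTrivial (Rep.trivial ℤ G ℤ)).toLinearEquiv⟩,
    E.nonempty_groupCohomology_one_equiv fun φ hmul hinv =>
      eq_zero_of_latticeAction_invariant p hp.ne_zero φ hmul hinv,
    E.nonempty_groupCohomology_two_equiv M hM (naturalRep p).dual hτ hΓ,
    E.nonempty_groupCohomology_three_equiv M hM hΓ,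
    fun i hi => by
      obtain ⟨n, rfl⟩ := Nat.exists_eq_add_of_le' hi
      exact E.subsingleton_groupCohomology hΓ n (triv G)⟩
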